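/- Let $(G,H,\alpha,\tau)$ be a Lie crossed module: $G,H$ are Lie groups, $\tau:H\to G$ is a smooth homomorphism and $\alpha:G\to\mathrm{Aut}(H)$ a homomorphism with $(g,h)\mapsto\alpha(g)h$ smooth, such that $\tau(\alpha(g)h)=g\tau(h)g^{-1}$ and $\alpha(\tau(h))h'=hh'h^{-1}$. Let $\pi:P\to M$ be a smooth principal $G$-bundle (with $G$ acting on the right of $P$), let $A$ and $\overline A$ be connection forms on it, and let $B$ be a smooth $L(H)$-valued $2$-form on $P$ that is $\alpha$-equivariant, $B_{pg}(vg,wg)=\alpha(g^{-1})B_p(v,w)$, and satisfies $B(v,w)=0$ whenever $\pi_*v=0$. For an $\overline A$-horizontal path $\tilde\gamma:[t_0,t_1]\to P$ and a vector field $\tilde v$ along $\tilde\gamma$ put $$\omega_{(A,B)}(\tilde v)=A\bigl(\tilde v(t_0)\bigr)+\tau\Bigl[\int_{t_0}^{t_1}B\bigl(\tilde\gamma'(t),\tilde v(t)\bigr)\,dt\Bigr]\in L(G),$$ where $\tau$ and $\alpha(g^{-1})$ also denote the derivatives at the identity. For a $C^\infty$ map $\Gamma:[s_0,s_1]\times[t_0,t_1]\to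 M$, $(u,v)\mapsto\Gamma_u(v)$, an $\omega_{(A,B)}$-horizontal lift of $u\mapsto\Gamma_u$ is a $C^\infty$ map $\tilde\Gamma:[s_0,s_1]\times[t_0,t_1]\to P$ with $\pi\circ\tilde\Gamma=\Gamma$ such that every path $\tilde\Gamma_u=\tilde\Gamma(u,\cdot)$ is $\overline A$-horizontal and $\omega_{(A,B)}\bigl(\partial_u\tilde\Gamma(u,\cdot)\bigr)=0$ for every $u\in[s_0,s_1]$. Let $s_0<s_1$, $t_0<t_1$, and let $\Gamma:[s_0,s_1]\times[t_0,t_1]\to M$ be a $C^\infty$ map such that $\partial_u\Gamma$ and $\partial_v\Gamma$ are linearly dependent at each point and $\Gamma(u,t_i)=\Gamma(s_0,t_i)$ for all $u\in[s_0,s_1]$ and $i\in\{0,1\}$. Let $\tilde\Gamma_0:[t_0,t_1]\to P$ be any $C^\infty$ $\overline A$-horizontal path that projects to $\Gamma_{s_0}$. For each $u\in[s_0,s_1]$ let $\tilde\Gamma_u:[t_0,t_1]\to P$ be the (existing and unique) $\overline A$-horizontal lift of $\Gamma_u$ with initial point $\tilde\Gamma_u(t_0)=\tilde\Gamma_0(t_0)$,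 and let $\tilde\Gamma(u,v)=\tilde\Gamma_u(v)$. Then: 1. $\tilde\Gamma$ is $C^\infty$ on $[s_0,s_1]\times[t_0,t_1]$, and $u\mapsto\tilde\Gamma_u$ is the unique $\omega_{(A,B)}$-horizontal lift of $u\mapsto\Gamma_u$ with $\tilde\Gamma_{s_0}=\tilde\Gamma_0$. 2. $\partial_u\tilde\Gamma$ and $\partial_v\tilde\Gamma$ are linearly dependent at each point of $[s_0,s_1]\times[t_0,t_1]$, and $\tilde\Gamma$ keeps the end points fixed: $\tilde\Gamma(u,t_i)=\tilde\Gamma_0(t_i)$ for all $u\in[s_0,s_1]$ and $i\in\{0,1\}$. -/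

import Mathlib

open Set
open scoped Manifold ContDiff RightActions

noncomputable section

namespace PathConn

section Group

variable {EG : Type*} [NormedAddCommGroup EG] [NormedSpace ℝ EG]
  {G : Type*} [TopologicalSpace G] [ChartedSpace EG G] [Group G]
  {EH : Type*} [NormedAddCommGroup EH] [NormedSpace ℝ EH]
  {H : Type*} [TopologicalSpace H] [ChartedSpace EH H] [Group H]

/-- The differential at the identity `L(G) → L(H)` of a group homomorphism `f : G → H`
(the tangent spaces of `H` at `f 1` and at `1` coincide, as `f 1 = 1`). -/
def lieMap (f : G →* H) : GroupLieAlgebra 𝓘(ℝ, EG) G →L[ℝ] GroupLieAlgebra 𝓘(ℝ, EH) H :=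
  mfderiv 𝓘(ℝ, EG) 𝓘(ℝ, EH) f 1

/-- The adjoint representation: `Ad g` is the differential at `1` of `x ↦ g * x * g⁻¹`. -/
def Ad (g : G) : GroupLieAlgebra 𝓘(ℝ, EG) G →L[ℝ] GroupLieAlgebra 𝓘(ℝ, EG) G :=
  lieMap (MulAut.conj g).toMonoidHom

/-- `(G, H, α, τ)` is a Lie crossed module. -/
structure IsLieCrossedModule (EG EH : Type*)
    [NormedAddCommGroup EG] [NormedSpace ℝ EG] [NormedAddCommGroup EH] [NormedSpace ℝ EH]
    {G : Type*} [TopologicalSpace G] [ChartedSpace EG G] [Group G]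
    {H : Type*} [TopologicalSpace H] [ChartedSpace EH H] [Group H]
    (α : G →* MulAut H) (τ : H →* G) : Prop where
  smooth_τ : ContMDiff 𝓘(ℝ, EH) 𝓘(ℝ, EG) ∞ τ
  smooth_α : ContMDiff (𝓘(ℝ, EG).prod 𝓘(ℝ, EH)) 𝓘(ℝ, EH) ∞ (fun x : G × H => α x.1 x.2)
  equivariant : ∀ g h, τ (α g h) = g * τ h * g⁻¹
  peiffer : ∀ h h', α (τ h) h' = h * h' * h⁻¹

end Group

/-- `π : P → M` is a smooth principal `G`-bundle; the right action of `G` on `P` is written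
`p <• g`. -/
structure IsPrincipalBundle (EG EM EP : Type*)
    [NormedAddCommGroup EG] [NormedSpace ℝ EG]
    [NormedAddCommGroup EM] [NormedSpace ℝ EM] [NormedAddCommGroup EP] [NormedSpace ℝ EP]
    (G : Type*) [TopologicalSpace G] [ChartedSpace EG G] [Group G]
    {M : Type*} [TopologicalSpace M] [ChartedSpace EM M]
    {P : Type*} [TopologicalSpace P] [ChartedSpace EP P] [MulAction Gᵐᵒᵖ P]
    (π : P → M) : Prop where
  smooth_proj : ContMDiff 𝓘(ℝ, EP) 𝓘(ℝ, EM) ∞ π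
  surjective : Function.Surjective π
  smooth_act : ContMDiff (𝓘(ℝ, EP).prod 𝓘(ℝ, EG)) 𝓘(ℝ, EP) ∞ (fun x : P × G => x.1 <• x.2)
  free : ∀ (p : P) (g : G), p <• g = p → g = 1
  proj_act : ∀ (p : P) (g : G), π (p <• g) = π p
  locally_trivial : ∀ x : M, ∃ U : Set M, IsOpen U ∧ x ∈ U ∧
    ∃ φ : OpenPartialHomeomorph (M × G) P,
      φ.source = U ×ˢ univ ∧ φ.target = π ⁻¹' U ∧
      ContMDiffOn (𝓘(ℝ, EM).prod 𝓘(ℝ, EG)) 𝓘(ℝ, EP) ∞ φ φ.source ∧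
      ContMDiffOn 𝓘(ℝ, EP) (𝓘(ℝ, EM).prod 𝓘(ℝ, EG)) ∞ φ.symm φ.target ∧
      ∀ u ∈ U, ∀ g h : G, φ (u, g) <• h = φ (u, g * h) ∧ π (φ (u, g)) = u

section Bundle

variable {EG : Type*} [NormedAddCommGroup EG] [NormedSpace ℝ EG]
  {G : Type*} [TopologicalSpace G] [ChartedSpace EG G] [Group G]
  {EH : Type*} [NormedAddCommGroup EH] [NormedSpace ℝ EH]
  {H : Type*} [TopologicalSpace H] [ChartedSpace EH H] [Group H]
  {EM : Type*} [NormedAddCommGroup EM] [NormedSpace ℝ EM]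
  {M : Type*} [TopologicalSpace M] [ChartedSpace EM M]
  {EP : Type*} [NormedAddCommGroup EP] [NormedSpace ℝ EP]
  {P : Type*} [TopologicalSpace P] [ChartedSpace EP P] [MulAction Gᵐᵒᵖ P]

/-- The derivative `v ↦ v g` of right translation by `g`, from `T_p P` to `T_{pg} P`. -/
def rightMap (EP : Type*) [NormedAddCommGroup EP] [NormedSpace ℝ EP]
    {P : Type*} [TopologicalSpace P] [ChartedSpace EP P] [MulAction Gᵐᵒᵖ P] (p : P) (g : G) :
    TangentSpace 𝓘(ℝ, EP) p →L[ℝ] TangentSpace 𝓘(ℝ, EP) (p <• g) :=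
  mfderiv 𝓘(ℝ, EP) 𝓘(ℝ, EP) (fun q : P => q <• g) p

/-- The value at `p` of the fundamental vector field of `Y ∈ L(G)`: the derivative at `t = 0` of
`p exp (t Y)`, which is the image of `Y` under the derivative at `1` of `g ↦ p g`. -/
def fundamental (EP : Type*) [NormedAddCommGroup EP] [NormedSpace ℝ EP]
    {P : Type*} [TopologicalSpace P] [ChartedSpace EP P] [MulAction Gᵐᵒᵖ P] (p : P)
    (Y : GroupLieAlgebra 𝓘(ℝ, EG) G) : TangentSpace 𝓘(ℝ, EP) p :=
  mfderiv 𝓘(ℝ, EG) 𝓘(ℝ, EP) (fun g : G => p <• g) 1 Y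

/-- `A` is a (smooth) connection form on the principal bundle `P`. -/
structure IsConnectionForm [IsManifold 𝓘(ℝ, EP) ∞ P]
    (A : ∀ p : P, TangentSpace 𝓘(ℝ, EP) p →L[ℝ] GroupLieAlgebra 𝓘(ℝ, EG) G) : Prop where
  smooth : ContMDiff 𝓘(ℝ, EP) (𝓘(ℝ, EP).prod 𝓘(ℝ, EP →L[ℝ] EG)) ∞
    (fun p => Bundle.TotalSpace.mk' (EP →L[ℝ] EG)
      (E := fun p : P => TangentSpace 𝓘(ℝ, EP) p →L[ℝ] Bundle.Trivial P EG p) p (A p))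
  equivariant : ∀ (p : P) (g : G) (v : TangentSpace 𝓘(ℝ, EP) p),
    A (p <• g) (rightMap EP p g v) = Ad g⁻¹ (A p v)
  vertical : ∀ (p : P) (Y : GroupLieAlgebra 𝓘(ℝ, EG) G), A p (fundamental EP p Y) = Y

/-- `B` is a (smooth) `α`-equivariant `L(H)`-valued 2-form on `P` that vanishes on vertical
vectors. -/
structure IsEquivariantTwoForm [IsManifold 𝓘(ℝ, EP) ∞ P] (EM : Type*) [NormedAddCommGroup EM]
    [NormedSpace ℝ EM] {M : Type*} [TopologicalSpace M] [ChartedSpace EM M]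
    (π : P → M) (α : G →* MulAut H)
    (B : ∀ p : P, TangentSpace 𝓘(ℝ, EP) p →L[ℝ] TangentSpace 𝓘(ℝ, EP) p →L[ℝ]
      GroupLieAlgebra 𝓘(ℝ, EH) H) : Prop where
  smooth : ContMDiff 𝓘(ℝ, EP) (𝓘(ℝ, EP).prod 𝓘(ℝ, EP →L[ℝ] EP →L[ℝ] EH)) ∞
    (fun p => Bundle.TotalSpace.mk' (EP →L[ℝ] EP →L[ℝ] EH)
      (E := fun p : P => TangentSpace 𝓘(ℝ, EP) p →L[ℝ] TangentSpace 𝓘(ℝ, EP) p →L[ℝ]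
        Bundle.Trivial P EH p) p (B p))
  alternating : ∀ (p : P) (v : TangentSpace 𝓘(ℝ, EP) p), B p v v = 0
  equivariant : ∀ (p : P) (g : G) (v w : TangentSpace 𝓘(ℝ, EP) p),
    B (p <• g) (rightMap EP p g v) (rightMap EP p g w)
      = lieMap (α g⁻¹).toMonoidHom (B p v w)
  vertical : ∀ (p : P) (v w : TangentSpace 𝓘(ℝ, EP) p),
    mfderiv 𝓘(ℝ, EP) 𝓘(ℝ, EM) π p v = 0 → B p v w = 0

/-- The velocity at `t` of a path `γ : [t₀, t₁] → X` (one-sided at the end points). -/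
def velocity (E : Type*) [NormedAddCommGroup E] [NormedSpace ℝ E]
    {X : Type*} [TopologicalSpace X] [ChartedSpace E X] (t₀ t₁ : ℝ) (γ : ℝ → X) (t : ℝ) :
    TangentSpace 𝓘(ℝ, E) (γ t) :=
  mfderivWithin 𝓘(ℝ, ℝ) 𝓘(ℝ, E) γ (Icc t₀ t₁) t (1 : ℝ)

/-- The maps `Γ : [s₀, s₁] × [t₀, t₁] → X` whose two partial derivatives are linearly dependent
at every point. -/
def IsThin (E : Type*) [NormedAddCommGroup E] [NormedSpace ℝ E]
    {X : Type*} [TopologicalSpace X] [ChartedSpace E X] (s₀ s₁ t₀ t₁ : ℝ) (Γ : ℝ × ℝ → X) : Prop :=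
  ∀ u ∈ Icc s₀ s₁, ∀ v ∈ Icc t₀ t₁,
    ¬ LinearIndependent ℝ (M := TangentSpace 𝓘(ℝ, E) (Γ (u, v)))
      ![velocity E s₀ s₁ (fun s => Γ (s, v)) u, velocity E t₀ t₁ (fun t => Γ (u, t)) v]

/-- `γ : [t₀, t₁] → P` is a `C^∞` path that is horizontal for the connection form `A`. -/
def IsHorizontalPath
    (A : ∀ p : P, TangentSpace 𝓘(ℝ, EP) p →L[ℝ] GroupLieAlgebra 𝓘(ℝ, EG) G)
    (t₀ t₁ : ℝ) (γ : ℝ → P) : Prop :=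
  ContMDiffOn 𝓘(ℝ, ℝ) 𝓘(ℝ, EP) ∞ γ (Icc t₀ t₁) ∧
    ∀ t ∈ Icc t₀ t₁, A (γ t) (velocity EP t₀ t₁ γ t) = 0

/-- `γ` is an `A`-horizontal lift to `P` of the path `c : [t₀, t₁] → M`. -/
def IsHorizontalLift {M : Type*} (π : P → M)
    (A : ∀ p : P, TangentSpace 𝓘(ℝ, EP) p →L[ℝ] GroupLieAlgebra 𝓘(ℝ, EG) G)
    (t₀ t₁ : ℝ) (c : ℝ → M) (γ : ℝ → P) : Prop :=
  IsHorizontalPath A t₀ t₁ γ ∧ ∀ t ∈ Icc t₀ t₁, π (γ t) = c t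

/-- The form `ω_(A,B)` evaluated on a vector field `v` along a path `γ : [t₀, t₁] → P`:
`A (v t₀) + τ (∫ B (γ' t, v t) dt)`, with `τ` also denoting the derivative `L(H) → L(G)`. -/
def omega (A : ∀ p : P, TangentSpace 𝓘(ℝ, EP) p →L[ℝ] GroupLieAlgebra 𝓘(ℝ, EG) G)
    (B : ∀ p : P, TangentSpace 𝓘(ℝ, EP) p →L[ℝ] TangentSpace 𝓘(ℝ, EP) p →L[ℝ]
      GroupLieAlgebra 𝓘(ℝ, EH) H)
    (τ : H →* G) (t₀ t₁ : ℝ) (γ : ℝ → P) (v : ∀ t, TangentSpace 𝓘(ℝ, EP) (γ t)) :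
    GroupLieAlgebra 𝓘(ℝ, EG) G :=
  A (γ t₀) (v t₀) +
    lieMap τ (∫ t in t₀..t₁, (B (γ t) (velocity EP t₀ t₁ γ t) (v t) : EH) : EH)

/-- `Γt : [s₀, s₁] × [t₀, t₁] → P`, viewed as the path `u ↦ Γt (u, ·)` in the space of
`Abar`-horizontal paths on `P`, is an `ω_(A,B)`-horizontal lift of the path of paths
`u ↦ Γ (u, ·)` on `M`. -/
structure IsOmegaHorizontalLift {M : Type*} (π : P → M)
    (Abar A : ∀ p : P, TangentSpace 𝓘(ℝ, EP) p →L[ℝ] GroupLieAlgebra 𝓘(ℝ, EG) G)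
    (B : ∀ p : P, TangentSpace 𝓘(ℝ, EP) p →L[ℝ] TangentSpace 𝓘(ℝ, EP) p →L[ℝ]
      GroupLieAlgebra 𝓘(ℝ, EH) H)
    (τ : H →* G) (s₀ s₁ t₀ t₁ : ℝ) (Γ : ℝ × ℝ → M) (Γt : ℝ × ℝ → P) : Prop where
  smooth : ContMDiffOn 𝓘(ℝ, ℝ × ℝ) 𝓘(ℝ, EP) ∞ Γt (Icc s₀ s₁ ×ˢ Icc t₀ t₁)
  lift : ∀ u ∈ Icc s₀ s₁,
    IsHorizontalLift π Abar t₀ t₁ (fun v => Γ (u, v)) (fun v => Γt (u, v))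
  horizontal : ∀ u ∈ Icc s₀ s₁,
    omega A B τ t₀ t₁ (fun v => Γt (u, v))
      (fun v => velocity EP s₀ s₁ (fun s => Γt (s, v)) u) = 0

end Bundle

end PathConn

end

open PathConn

/-! ### Estimates for ordinary differential equations -/

section HorizontalLifts

open Metric Filter Topology
open scoped NNReal

/-! The map `Γ` has rank at most one, so the pullback of the curvature of `Abar` along `Γ` vanishes:
the pulled-back bundle over the rectangle is flat, and the rectangle is simply connected. Hence
there is a smooth map `F` over `Γ`, horizontal for `Abar` in every direction of the rectangle, with
`F (s₀, t₀) = γ₀ t₀`.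

All claims are read off from `F`. Its restriction to a line `u = const` is the horizontal lift of
that path. On the edges `v = t₀` and `v = t₁` it is a horizontal curve over a constant one, hence
constant. Where a combination of the partial derivatives of `Γ` vanishes, the same combination for
`F` is vertical and horizontal, hence zero; so `F` is thin. For any smooth lift of `Γ` that
combination is still vertical, so the alternating form `B` vanishes on the two partial derivatives.
The `B`-integral thus drops out of `ω_(A,B)`, leaving the condition that the curve of initial points
be `A`-horizontal; over the constant edge `v = t₀` this forces it to be constant, which gives
uniqueness.

Flatness enters through Frobenius rather than through a curvature form. In a local trivialization,
horizontality of the graph of `g` is a total differential equation `Dg = η (x, g x)`. Its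
integrability condition follows because two vectors killed by the pulled-back connection form have
dependent images in `P`, so the exterior derivative of the form vanishes on them
(`exists_graph_tangent_ker_of_injective`). The equation is solved along rays
(`exists_hasFDerivWithinAt_of_integrable`) on convex sets with nonempty interior, which gives
smoothness up to the boundary of the rectangle. Local lifts are glued (`hasLiftOn_rectangle`), as
two of them differ by a constant of `G` (`IsHorizontalAt.exists_eventually_eq_act`). -/

theorem gronwallBound_zero_left (k e x : ℝ) :
    gronwallBound 0 k e x = e * gronwallBound 0 k 1 x := by
  by_cases hk : k = 0
  · subst hk; simp [gronwallBound_K0]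
  · simp [gronwallBound_of_K_ne_0 hk]; ring

/-- The confinement to the ball matters as much as the solution: later estimates on the right-hand
side hold only there. It comes from taking the fixed point of the Picard map in the space of curves
that cannot leave the ball. -/
theorem IsPicardLindelof.exists_hasDerivWithinAt_mem_closedBall
    {E : Type*} [NormedAddCommGroup E] [NormedSpace ℝ E] [CompleteSpace E]
    {f : ℝ → E → E} {tmin tmax : ℝ} {t₀ : Icc tmin tmax} {x₀ : E} {a L K : ℝ≥0}
    (hf : IsPicardLindelof f t₀ x₀ a 0 L K) :
    ∃ α : ℝ → E, α t₀ = x₀ ∧ (∀ t, α t ∈ closedBall x₀ a) ∧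
      ∀ t ∈ Icc tmin tmax, HasDerivWithinAt α (f t (α t)) (Icc tmin tmax) t := by
  have hx : x₀ ∈ closedBall x₀ ((0 : ℝ≥0) : ℝ) := mem_closedBall_self le_rfl
  obtain ⟨α, hα⟩ := ODE.FunSpace.exists_isFixedPt_next hf hx
  refine ⟨α.compProj, by rw [ODE.FunSpace.compProj_val, ← hα, ODE.FunSpace.next_apply₀],
    fun t => α.compProj_mem_closedBall hf.mul_max_le, fun t ht ↦ ?_⟩
  apply ODE.hasDerivWithinAt_picard_Icc t₀.2 hf.continuousOn_uncurry
    α.continuous_compProj.continuousOn (fun _ ht' ↦ α.compProj_mem_closedBall hf.mul_max_le)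
    x₀ ht |>.congr_of_mem _ ht
  intro t' ht'
  nth_rw 1 [← hα]
  rw [ODE.FunSpace.compProj_of_mem ht', ODE.FunSpace.next_apply]

/-! ### The Frobenius theorem for total differential equations -/

section Frobenius

variable {E' E : Type*} [NormedAddCommGroup E'] [NormedSpace ℝ E']
  [NormedAddCommGroup E] [NormedSpace ℝ E]

/-- Solutions along rays of a total differential equation `Dg = η (x, g x)`. -/
theorem exists_ray_solution [CompleteSpace E] {S : Set E'} (hS : Convex ℝ S) {x₀ : E'}
    (hx₀ : x₀ ∈ S) {y₀ : E} {ε ρ : ℝ} {C K : ℝ≥0} (hε : 0 < ε)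
    (hSρ : S ⊆ ball x₀ ρ) (hCρ : C * ρ ≤ ε / 2)
    {η : E' × E → E' →L[ℝ] E} (hK : LipschitzOnWith K η (S ×ˢ ball y₀ ε))
    (hC : ∀ z ∈ S ×ˢ ball y₀ ε, ‖η z‖ ≤ C) {x : E'} (hx : x ∈ S) :
    ∃ z : ℝ → E, z 0 = y₀ ∧ (∀ t, z t ∈ closedBall y₀ (ε / 2)) ∧
      ∀ t ∈ Icc (0 : ℝ) 1,
        HasDerivWithinAt z (η (x₀ + t • (x - x₀), z t) (x - x₀)) (Icc 0 1) t := by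
  have hρ : 0 ≤ ρ := by
    exact (nonempty_ball.mp ⟨x₀, hSρ hx₀⟩).le
  have hxρ : ‖x - x₀‖ ≤ ρ := by
    have := hSρ hx
    rw [mem_ball, dist_eq_norm] at this
    exact this.le
  have hmem : ∀ t ∈ Icc (0 : ℝ) 1, x₀ + t • (x - x₀) ∈ S := fun t ht =>
    hS.add_smul_sub_mem hx₀ hx ht
  have hball : closedBall y₀ (ε / 2) ⊆ ball y₀ ε := closedBall_subset_ball (by linarith)
  let f : ℝ → E → E := fun t y => η (x₀ + t • (x - x₀), y) (x - x₀)
  -- Half the available radius, so that a perturbation of the solution of size below `ε / 2` still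
  -- stays in `ball y₀ ε`.
  let a : ℝ≥0 := ⟨ε / 2, by positivity⟩
  let L : ℝ≥0 := C * ⟨ρ, hρ⟩
  have hpl : IsPicardLindelof f (⟨0, by simp⟩ : Icc (0 : ℝ) 1) y₀ a 0 L (K * ‖x - x₀‖₊) := by
    refine ⟨fun t ht => ?_, fun y hy => ?_, fun t ht y hy => ?_, ?_⟩
    · refine LipschitzOnWith.of_dist_le_mul fun y hy y' hy' => ?_
      have h1 := hK.dist_le_mul (x₀ + t • (x - x₀), y) ⟨hmem t ht, hball hy⟩
        (x₀ + t • (x - x₀), y') ⟨hmem t ht, hball hy'⟩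
      rw [dist_eq_norm, Prod.dist_eq] at h1
      simp only [dist_self, dist_nonneg, sup_of_le_right] at h1
      rw [dist_eq_norm]
      calc ‖f t y - f t y'‖
          = ‖(η (x₀ + t • (x - x₀), y) - η (x₀ + t • (x - x₀), y')) (x - x₀)‖ := by simp [f]
        _ ≤ _ := ContinuousLinearMap.le_opNorm _ _
        _ ≤ (K * dist y y') * ‖x - x₀‖ := by gcongr
        _ = _ := by push_cast; ring
    · have h1 : ContinuousOn (fun t : ℝ => η (x₀ + t • (x - x₀), y)) (Icc 0 1) := by
        refine hK.continuousOn.comp (f := fun t : ℝ => (x₀ + t • (x - x₀), y)) (by fun_prop) ?_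
        exact fun t ht => ⟨hmem t ht, hball hy⟩
      exact h1.clm_apply continuousOn_const
    · calc ‖f t y‖ ≤ _ := ContinuousLinearMap.le_opNorm _ _
        _ ≤ C * ρ := by
          gcongr
          exact hC _ ⟨hmem t ht, hball hy⟩
    · change (C : ℝ) * ρ * max (1 - 0) (0 - 0) ≤ ε / 2 - 0
      simpa using hCρ
  obtain ⟨z, h0, h1, h2⟩ := hpl.exists_hasDerivWithinAt_mem_closedBall
  exact ⟨z, h0, h1, h2⟩

/-- Second order Taylor estimate on a convex set. -/
theorem norm_sub_sub_le_of_lipschitzOnWith {X Y : Type*} [NormedAddCommGroup X] [NormedSpace ℝ X]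
    [NormedAddCommGroup Y] [NormedSpace ℝ Y] {D : Set X} (hD : Convex ℝ D) {f : X → Y}
    {f' : X → X →L[ℝ] Y} (hf : ∀ z ∈ D, HasFDerivWithinAt f (f' z) D z) {K : ℝ≥0}
    (hK : LipschitzOnWith K f' D) {p q : X} (hp : p ∈ D) (hq : q ∈ D) :
    ‖f q - f p - f' p (q - p)‖ ≤ K * ‖q - p‖ * ‖q - p‖ := by
  have hsub : segment ℝ p q ⊆ D := hD.segment_subset hp hq
  -- Mean value inequality on the segment from `p` to `q`, where `f'` differs from `f' p` by at most
  -- `K * ‖q - p‖`.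
  refine (convex_segment p q).norm_image_sub_le_of_norm_hasFDerivWithin_le' (f' := f')
    (fun z hz => (hf z (hsub hz)).mono hsub) (fun z hz => ?_) (left_mem_segment ℝ p q)
    (right_mem_segment ℝ p q)
  have h1 := hK.dist_le_mul z (hsub hz) p hp
  rw [dist_eq_norm, dist_eq_norm] at h1
  refine h1.trans ?_
  gcongr
  have := segment_subset_closedBall_left p q hz
  rw [mem_closedBall, dist_eq_norm, dist_eq_norm] at this
  rwa [norm_sub_rev q p]

/-- Comparison of the solutions of an integrable total differential equation along two rays. -/
theorem norm_ray_sub_le {S : Set E'} (hS : Convex ℝ S) {x₀ : E'}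
    (hx₀ : x₀ ∈ S) {y₀ : E} {ε : ℝ} {ρ C K : ℝ≥0}
    (hSρ : S ⊆ ball x₀ ρ)
    {η : E' × E → E' →L[ℝ] E} {η' : E' × E → E' × E →L[ℝ] E' →L[ℝ] E}
    (hη' : ∀ z ∈ S ×ˢ ball y₀ ε, HasFDerivWithinAt η (η' z) (S ×ˢ ball y₀ ε) z)
    (hK : LipschitzOnWith K η (S ×ˢ ball y₀ ε)) (hK' : LipschitzOnWith K η' (S ×ˢ ball y₀ ε))
    (hC : ∀ z ∈ S ×ˢ ball y₀ ε, ‖η z‖ ≤ C)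
    (hsymm : ∀ z ∈ S ×ˢ ball y₀ ε, ∀ ξ ξ', η' z (ξ, η z ξ) ξ' = η' z (ξ', η z ξ') ξ)
    {x x' : E'} (hx : x ∈ S) (hx' : x' ∈ S) (hxx' : C * ‖x' - x‖ < ε / 2) {z z' : ℝ → E}
    (hz0 : z 0 = y₀) (hz0' : z' 0 = y₀) (hzb : ∀ t, z t ∈ closedBall y₀ (ε / 2))
    (hzb' : ∀ t, z' t ∈ closedBall y₀ (ε / 2))
    (hz : ∀ t ∈ Icc (0 : ℝ) 1,
        HasDerivWithinAt z (η (x₀ + t • (x - x₀), z t) (x - x₀)) (Icc 0 1) t)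
    (hz' : ∀ t ∈ Icc (0 : ℝ) 1,
        HasDerivWithinAt z' (η (x₀ + t • (x' - x₀), z' t) (x' - x₀)) (Icc 0 1) t) :
    ‖z' 1 - z 1 - η (x, z 1) (x' - x)‖ ≤
      gronwallBound 0 (K * ρ) 1 1 * (K * (1 + C) ^ 2 * ρ + K * (1 + C)) *
        ‖x' - x‖ ^ 2 := by
  have hε : 0 < ε := by
    have := (mul_nonneg C.coe_nonneg (norm_nonneg (x' - x))).trans_lt hxx'
    linarith
  have hxρ : ‖x - x₀‖ ≤ ρ := by
    have := hSρ hx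
    rw [mem_ball, dist_eq_norm] at this
    exact this.le
  have hx'ρ : ‖x' - x₀‖ ≤ ρ := by
    have := hSρ hx'
    rw [mem_ball, dist_eq_norm] at this
    exact this.le
  have hmem : ∀ t ∈ Icc (0 : ℝ) 1, x₀ + t • (x - x₀) ∈ S := fun t ht =>
    hS.add_smul_sub_mem hx₀ hx ht
  have hmem' : ∀ t ∈ Icc (0 : ℝ) 1, x₀ + t • (x' - x₀) ∈ S := fun t ht =>
    hS.add_smul_sub_mem hx₀ hx' ht
  have hball : closedBall y₀ (ε / 2) ⊆ ball y₀ ε := closedBall_subset_ball (by linarith)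
  set δ := x' - x with hδ
  set ξ := x - x₀ with hξ
  have hx'ξ : x' - x₀ = ξ + δ := by rw [hδ, hξ]; abel
  let c : ℝ → E' × E := fun t => (x₀ + t • ξ, z t)
  have hc : ∀ t ∈ Icc (0 : ℝ) 1, c t ∈ S ×ˢ ball y₀ ε := fun t ht => ⟨hmem t ht, hball (hzb t)⟩
  -- First-order guess for the solution along the ray to `x'`: the point at time `t` moves by `t •
  -- δ`, so the solution should move by `η` applied to it. The integrability condition makes `w`
  -- solve the second ray equation up to an error of order `‖δ‖ ^ 2`, and Gronwall compares it with
  -- `z'`.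
  let w : ℝ → E := fun t => z t + t • η (c t) δ
  let w' : ℝ → E := fun t => η (c t) ξ + (t • η' (c t) (ξ, η (c t) ξ) δ + η (c t) δ)
  have hcd : ∀ t ∈ Icc (0 : ℝ) 1, HasDerivWithinAt c (ξ, η (c t) ξ) (Icc 0 1) t := by
    intro t ht
    refine HasDerivWithinAt.prodMk ?_ (hz t ht)
    simpa using ((hasDerivWithinAt_id t (Icc 0 1)).smul_const ξ).const_add x₀
  have hηc : ∀ t ∈ Icc (0 : ℝ) 1,
      HasDerivWithinAt (fun t => η (c t) δ) (η' (c t) (ξ, η (c t) ξ) δ) (Icc 0 1) t := by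
    intro t ht
    have := (hη' (c t) (hc t ht)).comp_hasDerivWithinAt t (hcd t ht) (fun s hs => hc s hs)
    simpa using this.clm_apply (hasDerivWithinAt_const t (Icc 0 1) δ)
  have hw : ∀ t ∈ Icc (0 : ℝ) 1, HasDerivWithinAt w (w' t) (Icc 0 1) t := by
    intro t ht
    have := (hz t ht).fun_add ((hasDerivWithinAt_id t (Icc 0 1)).fun_smul (hηc t ht))
    simpa [w, w', c] using this
  have hnη : ∀ t ∈ Icc (0 : ℝ) 1, ‖t • η (c t) δ‖ ≤ C * ‖δ‖ := by
    intro t ht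
    rw [norm_smul, Real.norm_of_nonneg ht.1]
    calc t * ‖η (c t) δ‖ ≤ 1 * (C * ‖δ‖) := by
          gcongr
          · exact ht.2
          · exact (ContinuousLinearMap.le_opNorm _ _).trans (by gcongr; exact hC _ (hc t ht))
      _ = _ := one_mul _
  have hwb : ∀ t ∈ Icc (0 : ℝ) 1, w t ∈ ball y₀ ε := by
    intro t ht
    have h1 := hzb t
    rw [mem_closedBall, dist_eq_norm] at h1
    rw [mem_ball, dist_eq_norm]
    calc ‖w t - y₀‖ = ‖(z t - y₀) + t • η (c t) δ‖ := by simp only [w]; congr 1; abel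
      _ ≤ _ := norm_add_le _ _
      _ < ε := by linarith [hnη t ht]
  let v : ℝ → E → E := fun t y => η (x₀ + t • (x' - x₀), y) (x' - x₀)
  have hv : ∀ t ∈ Ico (0 : ℝ) 1, LipschitzOnWith (K * ρ) (v t) (ball y₀ ε) := by
    intro t ht
    refine LipschitzOnWith.of_dist_le_mul fun y hy y' hy' => ?_
    have h1 := hK.dist_le_mul (x₀ + t • (x' - x₀), y) ⟨hmem' t (Ico_subset_Icc_self ht), hy⟩
      (x₀ + t • (x' - x₀), y') ⟨hmem' t (Ico_subset_Icc_self ht), hy'⟩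
    rw [dist_eq_norm, Prod.dist_eq] at h1
    simp only [dist_self, dist_nonneg, sup_of_le_right] at h1
    rw [dist_eq_norm]
    calc ‖v t y - v t y'‖
        = ‖(η (x₀ + t • (x' - x₀), y) - η (x₀ + t • (x' - x₀), y')) (x' - x₀)‖ := by simp [v]
      _ ≤ _ := ContinuousLinearMap.le_opNorm _ _
      _ ≤ (K * dist y y') * ρ := by gcongr
      _ = _ := by push_cast; ring
  have hIci : ∀ t ∈ Ico (0 : ℝ) 1, Icc (0 : ℝ) 1 ∈ 𝓝[≥] t := fun t ht =>
    Icc_mem_nhdsGE_of_mem ht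
  have herr : ∀ t ∈ Ico (0 : ℝ) 1,
      dist (w' t) (v t (w t)) ≤ (K * (1 + C) ^ 2 * ρ + K * (1 + C)) * ‖δ‖ ^ 2 := by
    intro t ht'
    have ht := Ico_subset_Icc_self ht'
    let d : E' × E := (t • δ, t • η (c t) δ)
    have hq : c t + d = (x₀ + t • (x' - x₀), w t) := by
      simp only [c, d, w, hx'ξ, Prod.mk_add_mk, smul_add]
      congr 1
      abel
    have hqm : c t + d ∈ S ×ˢ ball y₀ ε := by rw [hq]; exact ⟨hmem' t ht, hwb t ht⟩
    have hd : ‖d‖ ≤ (1 + C) * ‖δ‖ := by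
      rw [Prod.norm_def, sup_le_iff]
      constructor
      · simp only [d, norm_smul, Real.norm_of_nonneg ht.1]
        nlinarith [ht.2, norm_nonneg δ, mul_nonneg C.coe_nonneg (norm_nonneg δ)]
      · refine (hnη t ht).trans ?_
        nlinarith [norm_nonneg δ]
    -- The only use of integrability: it turns the derivative of `η δ` along the ray into the
    -- derivative of `η ξ` in the direction of displacement `d`, which is the first-order Taylor
    -- term below.
    have hdη : η' (c t) (ξ, η (c t) ξ) (t • δ) = η' (c t) d ξ := by
      rw [hsymm (c t) (hc t ht)]
      simp only [d, map_smul]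
    have hT := norm_sub_sub_le_of_lipschitzOnWith (hS.prod (convex_ball y₀ ε)) hη' hK' (hc t ht) hqm
    have hL := hK.dist_le_mul _ hqm _ (hc t ht)
    rw [dist_eq_norm] at hL
    rw [dist_eq_norm, add_sub_cancel_left] at hL
    rw [add_sub_cancel_left] at hT
    -- What remains is a Taylor remainder applied to `ξ` and an increment of `η` applied to `δ`,
    -- both quadratic in `δ`.
    have heq : w' t - v t (w t) = -((η (c t + d) - η (c t) - η' (c t) d) ξ)
        - (η (c t + d) - η (c t)) δ := by
      simp only [w', v]
      rw [← hq, hx'ξ]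
      rw [← map_smul, hdη]
      simp only [sub_apply, map_add]
      abel
    rw [dist_eq_norm, heq]
    calc _ ≤ ‖(η (c t + d) - η (c t) - η' (c t) d) ξ‖ + ‖(η (c t + d) - η (c t)) δ‖ := by
          refine (norm_sub_le _ _).trans ?_
          rw [norm_neg]
      _ ≤ (K * ‖d‖ * ‖d‖) * ρ + (K * ‖d‖) * ‖δ‖ := by
          gcongr
          · exact (ContinuousLinearMap.le_opNorm _ _).trans (by gcongr)
          · exact (ContinuousLinearMap.le_opNorm _ _).trans (by gcongr)
      _ ≤ (K * ((1 + C) * ‖δ‖) * ((1 + C) * ‖δ‖)) * ρ + (K * ((1 + C) * ‖δ‖)) * ‖δ‖ := by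
          gcongr
      _ = _ := by ring
  have hgron := dist_le_of_approx_trajectories_ODE_of_mem (v := v) (K := K * ρ)
    (s := fun _ => ball y₀ ε) (f := z') (g := w) (a := 0) (b := 1) (εf := 0) (δ := 0) hv
    (fun t ht => (hz' t ht).continuousWithinAt)
    (fun t ht => (hz' t (Ico_subset_Icc_self ht)).mono_of_mem_nhdsWithin (hIci t ht))
    (fun t ht => by simp [v]) (fun t ht => hball (hzb' t))
    (fun t ht => (hw t ht).continuousWithinAt)
    (fun t ht => (hw t (Ico_subset_Icc_self ht)).mono_of_mem_nhdsWithin (hIci t ht))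
    herr (fun t ht => hwb t (Ico_subset_Icc_self ht)) (by simp [w, hz0, hz0']) 1 (by simp)
  rw [gronwallBound_zero_left, dist_eq_norm] at hgron
  have h1 : z' 1 - z 1 - η (x, z 1) δ = z' 1 - w 1 := by
    simp only [w, c, hξ, one_smul, add_sub_cancel]
    abel
  rw [h1]
  refine hgron.trans (le_of_eq ?_)
  push_cast
  simp
  ring

/-- Bootstrapping: if `g` is `C^n`, then so is its derivative `η (x, g x)`, and `g` is `C^(n+1)`. -/
theorem ContDiffOn.of_hasFDerivWithinAt_comp_graph {S : Set E'} {D : Set (E' × E)}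
    {η : E' × E → E' →L[ℝ] E} (hη : ContDiffOn ℝ ∞ η D) {g : E' → E}
    (hD : ∀ x ∈ S, (x, g x) ∈ D) (hS : UniqueDiffOn ℝ S)
    (hg : ∀ x ∈ S, HasFDerivWithinAt g (η (x, g x)) S x) : ContDiffOn ℝ ∞ g S := by
  rw [contDiffOn_infty]
  intro n
  induction n with
  | zero =>
    exact contDiffOn_zero.2 fun x hx => (hg x hx).continuousWithinAt
  | succ n ih =>
    push_cast
    rw [contDiffOn_succ_iff_hasFDerivWithinAt_of_uniqueDiffOn hS]
    refine ⟨by simp, fun x => η (x, g x), ?_, hg⟩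
    exact (hη.of_le (by exact_mod_cast le_top)).comp (contDiffOn_id.prodMk ih) hD

/-- **Frobenius theorem**, local form, for the total differential equation `Dg = η (x, g x)` on a
convex set. -/
theorem exists_hasFDerivWithinAt_of_integrable [CompleteSpace E] {S : Set E'} (hS : Convex ℝ S)
    (hSi : (interior S).Nonempty) {V : Set E} (hV : IsOpen V) {η : E' × E → E' →L[ℝ] E}
    (hη : ContDiffOn ℝ ∞ η (S ×ˢ V))
    (hsymm : ∀ z ∈ S ×ˢ V, ∀ ξ ξ', fderivWithin ℝ η (S ×ˢ V) z (ξ, η z ξ) ξ' =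
      fderivWithin ℝ η (S ×ˢ V) z (ξ', η z ξ') ξ)
    {x₀ : E'} (hx₀ : x₀ ∈ S) {y₀ : E} (hy₀ : y₀ ∈ V) :
    ∃ g : E' → E, ∃ ρ > 0, g x₀ = y₀ ∧ (∀ x ∈ S ∩ ball x₀ ρ, g x ∈ V) ∧
      (∀ x ∈ S ∩ ball x₀ ρ, HasFDerivWithinAt g (η (x, g x)) S x) ∧
      ContDiffOn ℝ ∞ g (S ∩ ball x₀ ρ) := by
  have hSu : UniqueDiffOn ℝ S := uniqueDiffOn_convex hS hSi
  have hDu : UniqueDiffOn ℝ (S ×ˢ V) := hSu.prod hV.uniqueDiffOn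
  set η' := fderivWithin ℝ η (S ×ˢ V) with hη'def
  have hη' : ContDiffOn ℝ ∞ η' (S ×ˢ V) := hη.fderivWithin hDu (by simp)
  obtain ⟨ε₀, hε₀, hε₀V⟩ := Metric.isOpen_iff.1 hV y₀ hy₀
  have hz₀ : (x₀, y₀) ∈ S ×ˢ ball y₀ ε₀ := ⟨hx₀, mem_ball_self hε₀⟩
  have hsub₀ : S ×ˢ ball y₀ ε₀ ⊆ S ×ˢ V := prod_mono subset_rfl hε₀V
  have hconv := hS.prod (convex_ball y₀ ε₀)
  obtain ⟨K₁, t₁, ht₁, hK₁⟩ := (((hη.mono hsub₀) _ hz₀).of_le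
    (by exact_mod_cast le_top : (1 : ℕ∞ω) ≤ ∞)).exists_lipschitzOnWith hconv
  obtain ⟨K₂, t₂, ht₂, hK₂⟩ := (((hη'.mono hsub₀) _ hz₀).of_le
    (by exact_mod_cast le_top : (1 : ℕ∞ω) ≤ ∞)).exists_lipschitzOnWith hconv
  have hbd : ∀ᶠ z in 𝓝[S ×ˢ ball y₀ ε₀] (x₀, y₀), ‖η z‖ < ‖η (x₀, y₀)‖ + 1 :=
    ((hη.continuousOn.mono hsub₀) _ hz₀).norm.eventually (gt_mem_nhds (lt_add_one _))
  obtain ⟨ε₁, hε₁, hball₁⟩ := Metric.mem_nhdsWithin_iff.1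
    (Filter.inter_mem (Filter.inter_mem ht₁ ht₂) hbd)
  set ε := min ε₀ ε₁ with hε
  have hεpos : 0 < ε := lt_min hε₀ hε₁
  let C : ℝ≥0 := ‖η (x₀, y₀)‖₊ + 1
  have hCpos : (0 : ℝ) < C := by positivity
  -- With speed at most `C` times the length of the ray, solutions over this ball move by at most `ε
  -- / 2`.
  set ρ := min ε (ε / 2 / C) with hρ
  have hρpos : 0 < ρ := lt_min hεpos (by positivity)
  set T := S ∩ ball x₀ ρ with hT
  have hTconv : Convex ℝ T := hS.inter (convex_ball _ _)
  have hTx₀ : x₀ ∈ T := ⟨hx₀, mem_ball_self hρpos⟩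
  have hDsub : T ×ˢ ball y₀ ε ⊆ t₁ ∩ t₂ ∩ {z | ‖η z‖ < ‖η (x₀, y₀)‖ + 1} := by
    rintro ⟨x, y⟩ ⟨hx, hy⟩
    refine hball₁ ⟨?_, hx.1, ball_subset_ball (min_le_left _ _) hy⟩
    rw [← ball_prod_same]
    exact ⟨ball_subset_ball ((min_le_left _ _).trans (min_le_right _ _)) hx.2,
      ball_subset_ball (min_le_right _ _) hy⟩
  have hDV : T ×ˢ ball y₀ ε ⊆ S ×ˢ V :=
    prod_mono inter_subset_left ((ball_subset_ball (min_le_left _ _)).trans hε₀V)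
  let K := max K₁ K₂
  have hLip : LipschitzOnWith K η (T ×ˢ ball y₀ ε) :=
    (hK₁.mono fun z hz => (hDsub hz).1.1).weaken (le_max_left _ _)
  have hLip' : LipschitzOnWith K η' (T ×ˢ ball y₀ ε) :=
    (hK₂.mono fun z hz => (hDsub hz).1.2).weaken (le_max_right _ _)
  have hbound : ∀ z ∈ T ×ˢ ball y₀ ε, ‖η z‖ ≤ C := fun z hz => by
    have : ‖η z‖ < ‖η (x₀, y₀)‖ + 1 := (hDsub hz).2
    simpa [C] using this.le
  have hCρ : C * ρ ≤ ε / 2 := by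
    calc C * ρ ≤ C * (ε / 2 / C) := by gcongr; exact min_le_right _ _
      _ = ε / 2 := by field_simp
  have hray : ∀ x : T, _ := fun x =>
    exists_ray_solution hTconv hTx₀ hεpos inter_subset_right hCρ hLip hbound x.2
  choose z hz0 hzb hz using hray
  classical
  -- The time-one value of the solution along the ray from `x₀` to `x`; the value off `T` is
  -- arbitrary.
  let g : E' → E := fun x => if hx : x ∈ T then z ⟨x, hx⟩ 1 else y₀
  have hg : ∀ x (hx : x ∈ T), g x = z ⟨x, hx⟩ 1 := fun x hx => dif_pos hx
  have hgb : ∀ x ∈ T, g x ∈ ball y₀ ε := fun x hx => by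
    rw [hg x hx]
    exact closedBall_subset_ball (by linarith) (hzb _ _)
  have hderiv : ∀ x ∈ T, HasFDerivWithinAt g (η (x, g x)) T x := by
    intro x hx
    -- A remainder of quadratic order has derivative zero, so `η (x, g x)` is the derivative of `g`.
    have hO : (fun x' => g x' - g x - η (x, g x) (x' - x)) =O[𝓝[T] x] fun x' => ‖x' - x‖ ^ 2 := by
      refine Asymptotics.IsBigO.of_bound
        (gronwallBound 0 (K * ρ) 1 1 * (K * (1 + C) ^ 2 * ρ + K * (1 + C))) ?_
      have hnear : ∀ᶠ x' in 𝓝[T] x, C * ‖x' - x‖ < ε / 2 := by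
        have : Tendsto (fun x' => C * ‖x' - x‖) (𝓝[T] x) (𝓝 (C * ‖x - x‖)) :=
          Continuous.continuousWithinAt (by fun_prop)
        exact this.eventually (gt_mem_nhds (by simp; positivity))
      filter_upwards [hnear, self_mem_nhdsWithin] with x' hx'n hx'
      have h1 := norm_ray_sub_le hTconv hTx₀ (ε := ε) (ρ := ⟨ρ, hρpos.le⟩) inter_subset_right (C := C)
        (fun z hz => ((hη.differentiableOn (by simp) z (hDV hz)).hasFDerivWithinAt).mono hDV)
        hLip hLip' hbound (fun z hz => hsymm z (hDV hz)) hx hx' hx'n (hz0 ⟨x, hx⟩) (hz0 ⟨x', hx'⟩)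
        (hzb ⟨x, hx⟩) (hzb ⟨x', hx'⟩) (hz ⟨x, hx⟩) (hz ⟨x', hx'⟩)
      rw [hg x hx, hg x' hx']
      refine h1.trans ?_
      rw [norm_pow, norm_norm]
      rfl
    have h2 : HasFDerivWithinAt (fun x' => g x' - g x - η (x, g x) (x' - x)) (0 : E' →L[ℝ] E) T x :=
      hO.hasFDerivWithinAt hx (by norm_num)
    have h3 := (h2.add ((η (x, g x)).hasFDerivWithinAt (s := T) (x := x))).add_const
      (g x - η (x, g x) x)
    rw [zero_add] at h3
    refine HasFDerivWithinAt.congr' h3 (fun x' _ => ?_) hx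
    simp only [Pi.add_apply, map_sub]
    abel
  have hnhds : ∀ x ∈ T, T ∈ 𝓝[S] x := fun x hx =>
    inter_mem_nhdsWithin S (isOpen_ball.mem_nhds hx.2)
  have hTu : UniqueDiffOn ℝ T := hSu.inter isOpen_ball
  refine ⟨g, ρ, hρpos, ?_, fun x hx => (show (x, g x) ∈ S ×ˢ V from hDV ⟨hx, hgb x hx⟩).2,
    fun x hx => (hderiv x hx).mono_of_mem_nhdsWithin (hnhds x hx),
    hη.of_hasFDerivWithinAt_comp_graph (fun x hx => hDV ⟨hx, hgb x hx⟩) hTu hderiv⟩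
  -- The ray from `x₀` to itself has zero velocity, so the solution along it is constant.
  have h1 := (hz ⟨x₀, hTx₀⟩)
  simp only [sub_self, map_zero] at h1
  rw [hg x₀ hTx₀, ← hz0 ⟨x₀, hTx₀⟩]
  exact constant_of_has_deriv_right_zero (fun t ht => (h1 t ht).continuousWithinAt)
    (fun t ht => (h1 t (Ico_subset_Icc_self ht)).mono_of_mem_nhdsWithin (Icc_mem_nhdsGE_of_mem ht))
    1 (by simp)

end Frobenius

/-! ### Integrability of the kernel of a pulled-back one-form -/

theorem ContinuousLinearMap.apply_comm_of_not_linearIndependent {X Y : Type*}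
    [NormedAddCommGroup X] [NormedSpace ℝ X] [NormedAddCommGroup Y] [NormedSpace ℝ Y]
    (f : X →L[ℝ] X →L[ℝ] Y) {v w : X} (h : ¬ LinearIndependent ℝ ![v, w]) : f v w = f w v := by
  rw [LinearIndependent.pair_iff] at h
  push Not at h
  obtain ⟨s, t, hst, hne⟩ := h
  by_cases hs : s = 0
  · have ht := hne hs
    have hw : w = 0 := by simpa [hs, ht] using hst
    simp [hw]
  · have hv : v = (-(s⁻¹ * t)) • w := by
      have h1 : s • v = -(t • w) := eq_neg_of_add_eq_zero_left hst
      rw [neg_smul, mul_smul, ← smul_neg, ← h1, smul_smul, inv_mul_cancel₀ hs, one_smul]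
    rw [hv]
    simp

/-- Symmetry of second derivatives at a boundary point requires the point to be a limit of interior
points. -/
theorem Convex.mem_closure_interior_prod {X Y : Type*} [NormedAddCommGroup X] [NormedSpace ℝ X]
    [TopologicalSpace Y] {S : Set X} (hS : Convex ℝ S) (hSi : (interior S).Nonempty) {V : Set Y}
    (hV : IsOpen V) {z : X × Y} (hz : z ∈ S ×ˢ V) : z ∈ closure (interior (S ×ˢ V)) := by
  rw [interior_prod_eq, closure_prod_eq, hV.interior_eq]
  exact ⟨(hS.closure_interior_eq_closure_of_nonempty_interior hSi).symm ▸ subset_closure hz.1,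
    subset_closure hz.2⟩

section PullbackForm

variable {E' E X : Type*} [NormedAddCommGroup E'] [NormedSpace ℝ E']
  [NormedAddCommGroup E] [NormedSpace ℝ E] [NormedAddCommGroup X] [NormedSpace ℝ X]

/-- The exterior derivative of the pullback `θ` by `Ψ` of a 1-form `a`, in terms of the derivative
of `a`. -/
theorem fderivWithin_pullback_sub {Y : Type*} [NormedAddCommGroup Y] [NormedSpace ℝ Y]
    {D : Set Y} (hDu : UniqueDiffOn ℝ D) {Ψ : Y → X} (hΨ : ContDiffOn ℝ ∞ Ψ D) {Ω : Set X}
    (hΩ : IsOpen Ω) {a : X → X →L[ℝ] E} (ha : ContDiffOn ℝ ∞ a Ω) (hmaps : MapsTo Ψ D Ω)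
    {z : Y} (hz : z ∈ D) (hzi : z ∈ closure (interior D)) (w w' : Y) :
    fderivWithin ℝ (fun z => (a (Ψ z)).comp (fderivWithin ℝ Ψ D z)) D z w w' -
      fderivWithin ℝ (fun z => (a (Ψ z)).comp (fderivWithin ℝ Ψ D z)) D z w' w =
    fderiv ℝ a (Ψ z) (fderivWithin ℝ Ψ D z w) (fderivWithin ℝ Ψ D z w') -
      fderiv ℝ a (Ψ z) (fderivWithin ℝ Ψ D z w') (fderivWithin ℝ Ψ D z w) := by
  have h1 : HasFDerivWithinAt (fun z => a (Ψ z))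
      ((fderiv ℝ a (Ψ z)).comp (fderivWithin ℝ Ψ D z)) D z := by
    have h2 : HasFDerivAt a (fderiv ℝ a (Ψ z)) (Ψ z) :=
      ((ha.differentiableOn (by simp)).differentiableAt
        (hΩ.mem_nhds (hmaps hz))).hasFDerivAt
    exact h2.comp_hasFDerivWithinAt z
      ((hΨ.differentiableOn (by simp)) z hz).hasFDerivWithinAt
  have h3 : HasFDerivWithinAt (fderivWithin ℝ Ψ D) (fderivWithin ℝ (fderivWithin ℝ Ψ D) D z) D z :=
    (((hΨ.fderivWithin (m := ∞) hDu (by simp)).differentiableOn (by simp)) z hz).hasFDerivWithinAt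
  -- The second derivative of `Ψ` is symmetric, so it cancels from the antisymmetrized derivative:
  -- pullback commutes with the exterior derivative.
  have hsymm : IsSymmSndFDerivWithinAt ℝ Ψ D z :=
    (hΨ z hz).isSymmSndFDerivWithinAt (by simp only [minSmoothness_of_isRCLikeNormedField]; exact WithTop.coe_le_coe.2 (le_top : (2 : ℕ∞) ≤ ⊤)) hDu hzi hz
  rw [(h1.clm_comp h3).fderivWithin (hDu z hz)]
  simp only [add_apply, ContinuousLinearMap.comp_apply,
    ContinuousLinearMap.compL_apply, ContinuousLinearMap.flip_apply]
  rw [hsymm w w']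
  abel

/-- If the vectors killed by the pullback `θ` of a 1-form by `Ψ : S × V → X` have dependent images,
and `θ` is nondegenerate along `V`, then there are local functions `g : S → V` whose graph is
tangent to the kernel of `θ`. -/
theorem exists_graph_tangent_ker_of_injective [FiniteDimensional ℝ E] {S : Set E'}
    (hS : Convex ℝ S) (hSi : (interior S).Nonempty) {V : Set E} (hV : IsOpen V)
    {Ψ : E' × E → X} (hΨ : ContDiffOn ℝ ∞ Ψ (S ×ˢ V)) {Ω : Set X}
    (hΩ : IsOpen Ω) {a : X → X →L[ℝ] E} (ha : ContDiffOn ℝ ∞ a Ω) (hmaps : MapsTo Ψ (S ×ˢ V) Ω)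
    (hinj : ∀ z ∈ S ×ˢ V, IsUnit ((a (Ψ z)).comp
      ((fderivWithin ℝ Ψ (S ×ˢ V) z).comp (ContinuousLinearMap.inr ℝ E' E))))
    (hdep : ∀ z ∈ S ×ˢ V, ∀ w w', a (Ψ z) (fderivWithin ℝ Ψ (S ×ˢ V) z w) = 0 →
      a (Ψ z) (fderivWithin ℝ Ψ (S ×ˢ V) z w') = 0 →
      ¬ LinearIndependent ℝ ![fderivWithin ℝ Ψ (S ×ˢ V) z w, fderivWithin ℝ Ψ (S ×ˢ V) z w'])
    {x₀ : E'} (hx₀ : x₀ ∈ S) {y₀ : E} (hy₀ : y₀ ∈ V) :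
    ∃ g : E' → E, ∃ g' : E' → E' →L[ℝ] E, ∃ ρ > 0, g x₀ = y₀ ∧ (∀ x ∈ S ∩ ball x₀ ρ, g x ∈ V) ∧
      (∀ x ∈ S ∩ ball x₀ ρ, HasFDerivWithinAt g (g' x) S x) ∧
      (∀ x ∈ S ∩ ball x₀ ρ, ∀ ξ,
        a (Ψ (x, g x)) (fderivWithin ℝ Ψ (S ×ˢ V) (x, g x) (ξ, g' x ξ)) = 0) ∧
      ContDiffOn ℝ ∞ g (S ∩ ball x₀ ρ) := by
  have : CompleteSpace E := FiniteDimensional.complete ℝ E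
  set D := S ×ˢ V with hD
  have hDu : UniqueDiffOn ℝ D := (uniqueDiffOn_convex hS hSi).prod hV.uniqueDiffOn
  let θ : E' × E → E' × E →L[ℝ] E := fun z => (a (Ψ z)).comp (fderivWithin ℝ Ψ D z)
  let b : E' × E → E →L[ℝ] E := fun z => (θ z).comp (ContinuousLinearMap.inr ℝ E' E)
  -- Solving `θ z (ξ, ζ) = 0` for `ζ`: since `b z` is invertible, the kernel of `θ z` is the graph
  -- of `η z`.
  let η : E' × E → E' →L[ℝ] E := fun z =>
    -((Ring.inverse (b z)).comp ((θ z).comp (ContinuousLinearMap.inl ℝ E' E)))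
  have hθ : ContDiffOn ℝ ∞ θ D :=
    (ha.comp hΨ hmaps).clm_comp (hΨ.fderivWithin hDu (by simp))
  have hb : ContDiffOn ℝ ∞ b D := hθ.clm_comp contDiffOn_const
  have hbinv : ContDiffOn ℝ ∞ (fun z => Ring.inverse (b z)) D := by
    intro z hz
    obtain ⟨u, hu⟩ := hinj z hz
    have h1 : ContDiffAt ℝ ∞ Ring.inverse (b z) := by
      rw [show b z = u from hu.symm]
      exact contDiffAt_ringInverse ℝ u
    exact h1.comp_contDiffWithinAt z (hb z hz)
  have hη : ContDiffOn ℝ ∞ η D := (hbinv.clm_comp (hθ.clm_comp contDiffOn_const)).neg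
  have hker : ∀ z ∈ D, ∀ ξ, θ z (ξ, η z ξ) = 0 := by
    intro z hz ξ
    have h1 : θ z (ξ, η z ξ) = θ z (ξ, 0) + b z (η z ξ) := by
      simp only [b, ContinuousLinearMap.comp_apply, ContinuousLinearMap.inr_apply]
      rw [← map_add]
      simp
    have h2 : b z (Ring.inverse (b z) (θ z (ξ, 0))) = θ z (ξ, 0) := by
      have h3 : b z * Ring.inverse (b z) = 1 := Ring.mul_inverse_cancel _ (hinj z hz)
      exact congrArg (fun L : E →L[ℝ] E => L (θ z (ξ, 0))) h3
    rw [h1]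
    simp only [η, neg_apply, ContinuousLinearMap.comp_apply,
      ContinuousLinearMap.inl_apply, map_neg]
    rw [h2, add_neg_cancel]
  -- The derivative of the identity `θ z (ξ, η z ξ) = 0` in the direction `w`.
  have hdiff : ∀ z ∈ D, ∀ ξ w, fderivWithin ℝ θ D z w (ξ, η z ξ) =
      -(b z (fderivWithin ℝ η D z w ξ)) := by
    intro z hz ξ w
    have h1 : HasFDerivWithinAt θ (fderivWithin ℝ θ D z) D z :=
      (hθ.differentiableOn (by simp) z hz).hasFDerivWithinAt
    have h2 : HasFDerivWithinAt η (fderivWithin ℝ η D z) D z :=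
      (hη.differentiableOn (by simp) z hz).hasFDerivWithinAt
    have h3 := h1.clm_apply ((hasFDerivWithinAt_const ξ z D).prodMk
      (h2.clm_apply (hasFDerivWithinAt_const ξ z D)))
    have h4 : HasFDerivWithinAt (fun z => θ z (ξ, η z ξ)) (0 : E' × E →L[ℝ] E) D z :=
      HasFDerivWithinAt.congr' (hasFDerivWithinAt_const (0 : E) z D) (fun z' hz' => hker z' hz' ξ)
        hz
    have h5 := congrArg (fun L : E' × E →L[ℝ] E => L w) ((hDu z hz).eq h3 h4)
    simp only [add_apply, ContinuousLinearMap.comp_apply,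
      ContinuousLinearMap.flip_apply, ContinuousLinearMap.prod_apply,
      zero_apply, map_zero, zero_add] at h5
    rw [eq_neg_iff_add_eq_zero, add_comm]
    exact h5
  have hsymm : ∀ z ∈ D, ∀ ξ ξ', fderivWithin ℝ η D z (ξ, η z ξ) ξ' =
      fderivWithin ℝ η D z (ξ', η z ξ') ξ := by
    intro z hz ξ ξ'
    have h1 := fderivWithin_pullback_sub hDu hΨ hΩ ha hmaps hz
      (hS.mem_closure_interior_prod hSi hV hz) (ξ, η z ξ) (ξ', η z ξ')
    -- The two kernel vectors have dependent images under `Ψ`, so the exterior derivative of `θ`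
    -- vanishes on them. By `hdiff` and invertibility of `b z` this is the integrability condition
    -- for `η`.
    rw [(fderiv ℝ a (Ψ z)).apply_comm_of_not_linearIndependent
      (hdep z hz _ _ (hker z hz ξ) (hker z hz ξ')), sub_self, sub_eq_zero] at h1
    have h2 := (hdiff z hz ξ' (ξ, η z ξ)).symm.trans (h1.trans (hdiff z hz ξ (ξ', η z ξ')))
    have h3 : Ring.inverse (b z) * b z = 1 := Ring.inverse_mul_cancel _ (hinj z hz)
    have h5 : ∀ y, Ring.inverse (b z) (b z y) = y := fun y =>
      congrArg (fun L : E →L[ℝ] E => L y) h3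
    rw [← h5 (fderivWithin ℝ η D z (ξ, η z ξ) ξ'), neg_injective h2, h5]
  obtain ⟨g, ρ, hρ, hg0, hgV, hgd, hgs⟩ :=
    exists_hasFDerivWithinAt_of_integrable hS hSi hV hη hsymm hx₀ hy₀
  exact ⟨g, fun x => η (x, g x), ρ, hρ, hg0, hgV, hgd,
    fun x hx ξ => hker (x, g x) ⟨hx.1, hgV x hx⟩ ξ, hgs⟩

/-- Nondegeneracy at one point suffices: in finite dimension an injective endomorphism is a unit,
units form an open set, and the domain can be shrunk. -/
theorem exists_graph_tangent_ker [FiniteDimensional ℝ E] {S : Set E'}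
    (hS : Convex ℝ S) (hSi : (interior S).Nonempty) {V : Set E} (hV : IsOpen V)
    {Ψ : E' × E → X} (hΨ : ContDiffOn ℝ ∞ Ψ (S ×ˢ V)) {Ω : Set X}
    (hΩ : IsOpen Ω) {a : X → X →L[ℝ] E} (ha : ContDiffOn ℝ ∞ a Ω) (hmaps : MapsTo Ψ (S ×ˢ V) Ω)
    (hdep : ∀ z ∈ S ×ˢ V, ∀ w w', a (Ψ z) (fderivWithin ℝ Ψ (S ×ˢ V) z w) = 0 →
      a (Ψ z) (fderivWithin ℝ Ψ (S ×ˢ V) z w') = 0 →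
      ¬ LinearIndependent ℝ ![fderivWithin ℝ Ψ (S ×ˢ V) z w, fderivWithin ℝ Ψ (S ×ˢ V) z w'])
    {x₀ : E'} (hx₀ : x₀ ∈ S) {y₀ : E} (hy₀ : y₀ ∈ V)
    (hinj : ∀ ζ : E, a (Ψ (x₀, y₀)) (fderivWithin ℝ Ψ (S ×ˢ V) (x₀, y₀) (0, ζ)) = 0 → ζ = 0) :
    ∃ g : E' → E, ∃ g' : E' → E' →L[ℝ] E, ∃ ρ > 0, g x₀ = y₀ ∧ (∀ x ∈ S ∩ ball x₀ ρ, g x ∈ V) ∧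
      (∀ x ∈ S ∩ ball x₀ ρ, HasFDerivWithinAt g (g' x) S x) ∧
      (∀ x ∈ S ∩ ball x₀ ρ, ∀ ξ,
        a (Ψ (x, g x)) (fderivWithin ℝ Ψ (S ×ˢ V) (x, g x) (ξ, g' x ξ)) = 0) ∧
      ContDiffOn ℝ ∞ g (S ∩ ball x₀ ρ) := by
  have : CompleteSpace E := FiniteDimensional.complete ℝ E
  have hDu : UniqueDiffOn ℝ (S ×ˢ V) := (uniqueDiffOn_convex hS hSi).prod hV.uniqueDiffOn
  let b : E' × E → E →L[ℝ] E := fun z => (a (Ψ z)).comp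
    ((fderivWithin ℝ Ψ (S ×ˢ V) z).comp (ContinuousLinearMap.inr ℝ E' E))
  have hb : ContinuousOn b (S ×ˢ V) :=
    (ContDiffOn.clm_comp (ha.comp hΨ hmaps) (ContDiffOn.clm_comp
      (hΨ.fderivWithin (m := ∞) hDu (by simp)) contDiffOn_const)).continuousOn
  have hb₀ : IsUnit (b (x₀, y₀)) := by
    have hi : Function.Injective (b (x₀, y₀)) := by
      rw [injective_iff_map_eq_zero]
      intro ζ hζ
      exact hinj ζ (by simpa [b] using hζ)
    let e : E ≃ₗ[ℝ] E := LinearEquiv.ofInjectiveEndo (b (x₀, y₀) : E →ₗ[ℝ] E) hi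
    refine ⟨ContinuousLinearEquiv.toUnit e.toContinuousLinearEquiv, ?_⟩
    ext ζ
    rfl
  have hz₀ : (x₀, y₀) ∈ S ×ˢ V := ⟨hx₀, hy₀⟩
  have hev : ∀ᶠ z in 𝓝[S ×ˢ V] (x₀, y₀), IsUnit (b z) :=
    (hb _ hz₀).eventually (Units.isOpen.mem_nhds hb₀)
  obtain ⟨ε, hε, hεu⟩ := Metric.mem_nhdsWithin_iff.1 hev
  set T := S ∩ ball x₀ ε with hT
  set W := V ∩ ball y₀ ε with hW
  have hsub : T ×ˢ W ⊆ S ×ˢ V := prod_mono inter_subset_left inter_subset_left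
  have hTc : Convex ℝ T := hS.inter (convex_ball _ _)
  have hTi : (interior T).Nonempty := by
    rw [hT, interior_inter, isOpen_ball.interior_eq]
    have h1 : x₀ ∈ closure (interior S) :=
      (hS.closure_interior_eq_closure_of_nonempty_interior hSi).symm ▸ subset_closure hx₀
    rw [inter_comm]
    exact mem_closure_iff.1 h1 _ isOpen_ball (mem_ball_self hε)
  have hWo : IsOpen W := hV.inter isOpen_ball
  have hTWu : UniqueDiffOn ℝ (T ×ˢ W) := (uniqueDiffOn_convex hTc hTi).prod hWo.uniqueDiffOn
  have hf : ∀ z ∈ T ×ˢ W, fderivWithin ℝ Ψ (T ×ˢ W) z = fderivWithin ℝ Ψ (S ×ˢ V) z :=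
    fun z hz => fderivWithin_subset hsub (hTWu z hz) (hΨ.differentiableOn (by simp) z (hsub hz))
  obtain ⟨g, g', ρ, hρ, hg0, hgV, hgd, hgk, hgs⟩ := exists_graph_tangent_ker_of_injective hTc hTi hWo
    (hΨ.mono hsub) hΩ ha (hmaps.mono_left hsub)
    (fun z hz => by
      rw [hf z hz]
      refine hεu ⟨?_, hsub hz⟩
      rw [← ball_prod_same]
      exact ⟨hz.1.2, hz.2.2⟩)
    (fun z hz w w' => by rw [hf z hz]; exact hdep z (hsub hz) w w')
    (x₀ := x₀) ⟨hx₀, mem_ball_self hε⟩ (y₀ := y₀) ⟨hy₀, mem_ball_self hε⟩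
  have hmem : ∀ x ∈ S ∩ ball x₀ (min ε ρ), x ∈ T ∩ ball x₀ ρ := fun x hx =>
    ⟨⟨hx.1, ball_subset_ball (min_le_left _ _) hx.2⟩, ball_subset_ball (min_le_right _ _) hx.2⟩
  refine ⟨g, g', min ε ρ, lt_min hε hρ, hg0, fun x hx => (hgV x (hmem x hx)).1, fun x hx => ?_,
    fun x hx ξ => ?_, hgs.mono hmem⟩
  · exact (hgd x (hmem x hx)).mono_of_mem_nhdsWithin
      (inter_mem_nhdsWithin S (isOpen_ball.mem_nhds (hmem x hx).1.2))
  · rw [← hf _ ⟨(hmem x hx).1, hgV x (hmem x hx)⟩]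
    exact hgk x (hmem x hx) ξ

end PullbackForm

/-! ### Connection forms and the derivative of the group action -/

namespace PathConn

/-- All tangent spaces of `P` are the model space `EP` by definition, so the same `v` can be read at
`p` and at `q`. This moves a form between equal base points without a cast. -/
theorem tangent_fun_congr {EP : Type*} [NormedAddCommGroup EP] [NormedSpace ℝ EP]
    {P : Type*} [TopologicalSpace P] [ChartedSpace EP P] {X : Type*}
    (A : ∀ p : P, TangentSpace 𝓘(ℝ, EP) p → X) {p q : P} (h : p = q) (v : EP) :
    A p v = A q v := by
  subst h; rfl

section Horizontal

variable {EG : Type*} [NormedAddCommGroup EG] [NormedSpace ℝ EG]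
  {G : Type*} [TopologicalSpace G] [ChartedSpace EG G] [Group G]
  {EM : Type*} [NormedAddCommGroup EM] [NormedSpace ℝ EM]
  {M : Type*} [TopologicalSpace M] [ChartedSpace EM M]
  {EP : Type*} [NormedAddCommGroup EP] [NormedSpace ℝ EP]
  {P : Type*} [TopologicalSpace P] [ChartedSpace EP P] [MulAction Gᵐᵒᵖ P]

/-- The left Maurer–Cartan form of `G`. -/
noncomputable def maurerCartan (k : G) :
    TangentSpace 𝓘(ℝ, EG) k →L[ℝ] GroupLieAlgebra 𝓘(ℝ, EG) G :=
  mfderiv 𝓘(ℝ, EG) 𝓘(ℝ, EG) (fun g : G => k⁻¹ * g) k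

theorem maurerCartan_eq_zero [LieGroup 𝓘(ℝ, EG) ∞ G] {k : G} {ζ : TangentSpace 𝓘(ℝ, EG) k}
    (h : maurerCartan k ζ = 0) : ζ = 0 := by
  have h1 : HasMFDerivAt 𝓘(ℝ, EG) 𝓘(ℝ, EG) (fun g : G => k⁻¹ * g) k
      (mfderiv 𝓘(ℝ, EG) 𝓘(ℝ, EG) (fun g : G => k⁻¹ * g) k) :=
    ((contMDiff_mul_left (I := 𝓘(ℝ, EG)) (n := ∞) (a := k⁻¹)).mdifferentiable (by simp)
      k).hasMFDerivAt
  have h2 : HasMFDerivAt 𝓘(ℝ, EG) 𝓘(ℝ, EG) (fun g : G => k * g) (k⁻¹ * k)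
      (mfderiv 𝓘(ℝ, EG) 𝓘(ℝ, EG) (fun g : G => k * g) (k⁻¹ * k)) :=
    ((contMDiff_mul_left (I := 𝓘(ℝ, EG)) (n := ∞) (a := k)).mdifferentiable (by simp)
      _).hasMFDerivAt
  have h3 := HasMFDerivAt.comp k h2 h1
  have h4 : (fun g : G => k * g) ∘ (fun g : G => k⁻¹ * g) = id := by
    funext g; simp
  rw [h4] at h3
  have h5 := hasMFDerivAt_unique (hasMFDerivAt_id k) h3
  have h6 := congrArg (fun L : EG →L[ℝ] EG => L ζ) h5
  refine h6.trans ?_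
  exact (congrArg (mfderiv 𝓘(ℝ, EG) 𝓘(ℝ, EG) (fun g : G => k * g) (k⁻¹ * k)) h).trans (map_zero _)

/-- Local triviality in terms of a local section `σ` and a fibre coordinate `k`. -/
theorem IsPrincipalBundle.exists_section {π : P → M} (hπ : IsPrincipalBundle EG EM EP G π) (x : M) :
    ∃ U : Set M, IsOpen U ∧ x ∈ U ∧ ∃ (σ : M → P) (k : P → G),
      ContMDiffOn 𝓘(ℝ, EM) 𝓘(ℝ, EP) ∞ σ U ∧ ContMDiffOn 𝓘(ℝ, EP) 𝓘(ℝ, EG) ∞ k (π ⁻¹' U) ∧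
      (∀ q ∈ π ⁻¹' U, σ (π q) <• k q = q) ∧ ∀ u ∈ U, π (σ u) = u := by
  obtain ⟨U, hU, hxU, φ, hsrc, htgt, hφ, hφs, hφa⟩ := hπ.locally_trivial x
  refine ⟨U, hU, hxU, fun x => φ (x, 1), fun q => (φ.symm q).2, ?_, ?_, ?_,
    fun u hu => (hφa u hu 1 1).2⟩
  · refine hφ.comp (f := fun x : M => (x, (1 : G)))
      (contMDiff_id.prodMk contMDiff_const).contMDiffOn fun u hu => ?_
    rw [mem_preimage, hsrc]
    exact ⟨hu, mem_univ _⟩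
  · rw [← htgt]
    exact contMDiff_snd.comp_contMDiffOn hφs
  · intro q hq
    have hq' : q ∈ φ.target := by rw [htgt]; exact hq
    have h1 : φ.symm q ∈ φ.source := φ.map_target hq'
    rw [hsrc] at h1
    have h2 := (hφa (φ.symm q).1 h1.1 (φ.symm q).2 1).2
    rw [Prod.mk.eta, φ.right_inv hq'] at h2
    rw [(hφa (π q) hq 1 (φ.symm q).2).1, one_mul, h2, Prod.mk.eta, φ.right_inv hq']

/-- Leibniz rule: the derivative of the action splits into its partial derivatives in `P` and in
`G`. -/
theorem hasMFDerivWithinAt_act [IsManifold 𝓘(ℝ, EP) ∞ P] [LieGroup 𝓘(ℝ, EG) ∞ G]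
    (hact : ContMDiff (𝓘(ℝ, EP).prod 𝓘(ℝ, EG)) 𝓘(ℝ, EP) ∞ (fun x : P × G => x.1 <• x.2))
    {EN : Type*} [NormedAddCommGroup EN] [NormedSpace ℝ EN]
    {N : Type*} [TopologicalSpace N] [ChartedSpace EN N] {F : N → P} {k : N → G} {S : Set N}
    {x : N} {F' : TangentSpace 𝓘(ℝ, EN) x →L[ℝ] TangentSpace 𝓘(ℝ, EP) (F x)}
    {k' : TangentSpace 𝓘(ℝ, EN) x →L[ℝ] TangentSpace 𝓘(ℝ, EG) (k x)}
    (hF : HasMFDerivWithinAt 𝓘(ℝ, EN) 𝓘(ℝ, EP) F S x F')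
    (hk : HasMFDerivWithinAt 𝓘(ℝ, EN) 𝓘(ℝ, EG) k S x k') :
    HasMFDerivWithinAt 𝓘(ℝ, EN) 𝓘(ℝ, EP) (fun y => F y <• k y) S x
      ((rightMap EP (F x) (k x)).comp F' +
        (mfderiv 𝓘(ℝ, EG) 𝓘(ℝ, EP) (fun g : G => F x <• g) (k x)).comp k') := by
  have h1 : MDifferentiableAt (𝓘(ℝ, EP).prod 𝓘(ℝ, EG)) 𝓘(ℝ, EP)
      (fun x : P × G => x.1 <• x.2) (F x, k x) := hact.mdifferentiable (by simp) _
  have h2 := HasMFDerivAt.comp_hasMFDerivWithinAt x h1.hasMFDerivAt (hF.prodMk hk)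
  have h3 : (rightMap EP (F x) (k x)).comp F' +
      (mfderiv 𝓘(ℝ, EG) 𝓘(ℝ, EP) (fun g : G => F x <• g) (k x)).comp k' =
      (mfderiv (𝓘(ℝ, EP).prod 𝓘(ℝ, EG)) 𝓘(ℝ, EP)
        (fun x : P × G => x.1 <• x.2) (F x, k x)).comp (F'.prod k') := by
    ext ξ
    exact (mfderiv_prod_eq_add_apply
      (v := ((F' ξ, k' ξ) : TangentSpace (𝓘(ℝ, EP).prod 𝓘(ℝ, EG)) (F x, k x))) h1).symm
  rw [h3]
  exact h2

variable [IsManifold 𝓘(ℝ, EP) ∞ P] [LieGroup 𝓘(ℝ, EG) ∞ G] {π : P → M}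
  {A : ∀ p : P, TangentSpace 𝓘(ℝ, EP) p →L[ℝ] GroupLieAlgebra 𝓘(ℝ, EG) G}

/-- Since `p g = (p k) (k⁻¹ g)`, a tangent vector to the orbit at `p k` is the fundamental vector of
its Maurer–Cartan value. -/
theorem IsConnectionForm.apply_mfderiv_orbit (hA : IsConnectionForm A)
    (hact : ContMDiff (𝓘(ℝ, EP).prod 𝓘(ℝ, EG)) 𝓘(ℝ, EP) ∞ (fun x : P × G => x.1 <• x.2))
    (p : P) (k : G) (ζ : TangentSpace 𝓘(ℝ, EG) k) :
    A (p <• k) (mfderiv 𝓘(ℝ, EG) 𝓘(ℝ, EP) (fun g : G => p <• g) k ζ) = maurerCartan k ζ := by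
  have h1 : (fun g : G => p <• g) = (fun h : G => (p <• k) <• h) ∘ (fun g : G => k⁻¹ * g) := by
    funext g
    simp only [Function.comp_apply, smul_smul, ← MulOpposite.op_mul, mul_inv_cancel_left]
  have h2 : ∀ q : P, MDifferentiable 𝓘(ℝ, EG) 𝓘(ℝ, EP) (fun g : G => q <• g) := fun q =>
    (hact.comp (contMDiff_const.prodMk contMDiff_id)).mdifferentiable (by simp)
  have h3 : MDifferentiable 𝓘(ℝ, EG) 𝓘(ℝ, EG) (fun g : G => k⁻¹ * g) :=
    (contMDiff_mul_left (I := 𝓘(ℝ, EG)) (n := ∞) (a := k⁻¹)).mdifferentiable (by simp)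
  have h4 : mfderiv 𝓘(ℝ, EG) 𝓘(ℝ, EP) (fun g : G => p <• g) k ζ =
      fundamental EP (p <• k) (maurerCartan k ζ) := by
    have h5 : ∀ h : G, h = 1 → ∀ Y : EG,
        mfderiv 𝓘(ℝ, EG) 𝓘(ℝ, EP) (fun g : G => (p <• k) <• g) h Y =
          fundamental (G := G) EP (p <• k) (Y : GroupLieAlgebra 𝓘(ℝ, EG) G) := by
      rintro _ rfl Y
      rfl
    rw [h1, mfderiv_comp k (h2 _ _) (h3 k)]
    exact h5 (k⁻¹ * k) (by simp) _
  rw [h4]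
  exact hA.vertical _ _

/-- The gauge transformation rule `A (d(F k)) = Ad k⁻¹ (A dF) + k⁻¹ dk`, on which both uniqueness of
lifts and nondegeneracy in the fibre directions rest. -/
theorem IsConnectionForm.apply_act (hA : IsConnectionForm A)
    (hact : ContMDiff (𝓘(ℝ, EP).prod 𝓘(ℝ, EG)) 𝓘(ℝ, EP) ∞ (fun x : P × G => x.1 <• x.2))
    (p : P) (k : G) (v : TangentSpace 𝓘(ℝ, EP) p) (ζ : TangentSpace 𝓘(ℝ, EG) k) :
    A (p <• k) (rightMap EP p k v + mfderiv 𝓘(ℝ, EG) 𝓘(ℝ, EP) (fun g : G => p <• g) k ζ) =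
      Ad k⁻¹ (A p v) + maurerCartan k ζ := by
  rw [map_add, hA.equivariant, hA.apply_mfderiv_orbit hact]

theorem IsConnectionForm.apply_act_of_eq_zero (hA : IsConnectionForm A)
    (hact : ContMDiff (𝓘(ℝ, EP).prod 𝓘(ℝ, EG)) 𝓘(ℝ, EP) ∞ (fun x : P × G => x.1 <• x.2))
    {p : P} (k : G) {v : TangentSpace 𝓘(ℝ, EP) p} (hv : A p v = 0) (ζ : TangentSpace 𝓘(ℝ, EG) k) :
    A (p <• k) (rightMap EP p k v + mfderiv 𝓘(ℝ, EG) 𝓘(ℝ, EP) (fun g : G => p <• g) k ζ) =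
      maurerCartan k ζ := by
  rw [hA.apply_act hact, hv, map_zero, zero_add]

/-- A vector that is both vertical and horizontal vanishes. -/
theorem IsConnectionForm.eq_zero_of_vertical (hA : IsConnectionForm A)
    (hπ : IsPrincipalBundle EG EM EP G π) {p : P} {v : TangentSpace 𝓘(ℝ, EP) p}
    (hv : mfderiv 𝓘(ℝ, EP) 𝓘(ℝ, EM) π p v = 0) (hAv : A p v = 0) : v = 0 := by
  obtain ⟨U, hU, hpU, σ, k, hσ, hk, hσk, -⟩ := hπ.exists_section (π p)
  have hUo : IsOpen (π ⁻¹' U) := hU.preimage hπ.smooth_proj.continuous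
  replace hσ : MDifferentiableAt 𝓘(ℝ, EM) 𝓘(ℝ, EP) σ (π p) :=
    (hσ.contMDiffAt (hU.mem_nhds hpU)).mdifferentiableAt (by simp)
  replace hk : MDifferentiableAt 𝓘(ℝ, EP) 𝓘(ℝ, EG) k p :=
    (hk.contMDiffAt (hUo.mem_nhds hpU)).mdifferentiableAt (by simp)
  have hπd : MDifferentiableAt 𝓘(ℝ, EP) 𝓘(ℝ, EM) π p := hπ.smooth_proj.mdifferentiable (by simp) p
  -- Differentiating `q = σ (π q) <• k q` at `p`: for vertical `v` only the term with `dk v`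
  -- survives, and `A p v = 0` makes the Maurer–Cartan value of `dk v` vanish.
  have h1 := hasMFDerivWithinAt_act (F := fun q => σ (π q)) (k := k) hπ.smooth_act
    ((HasMFDerivAt.comp p hσ.hasMFDerivAt hπd.hasMFDerivAt).hasMFDerivWithinAt (s := univ))
    (hk.hasMFDerivAt.hasMFDerivWithinAt (s := univ))
  rw [hasMFDerivWithinAt_univ] at h1
  have h2 := h1.congr_of_eventuallyEq (f₁ := id)
    (by filter_upwards [hUo.mem_nhds hpU] with q hq using (hσk q hq).symm)
  have h3 := hasMFDerivAt_unique (hasMFDerivAt_id p) h2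
  have h4 : (v : EP) = rightMap EP (σ (π p)) (k p)
      (mfderiv 𝓘(ℝ, EM) 𝓘(ℝ, EP) σ (π p) (mfderiv 𝓘(ℝ, EP) 𝓘(ℝ, EM) π p v)) +
      mfderiv 𝓘(ℝ, EG) 𝓘(ℝ, EP) (fun g : G => σ (π p) <• g) (k p)
        (mfderiv 𝓘(ℝ, EP) 𝓘(ℝ, EG) k p v) := congrArg (fun L : EP →L[ℝ] EP => L v) h3
  have h5 := hA.apply_act hπ.smooth_act (σ (π p)) (k p)
    (mfderiv 𝓘(ℝ, EM) 𝓘(ℝ, EP) σ (π p) (mfderiv 𝓘(ℝ, EP) 𝓘(ℝ, EM) π p v))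
    (mfderiv 𝓘(ℝ, EP) 𝓘(ℝ, EG) k p v)
  rw [← h4, tangent_fun_congr (fun q v => A q v) (hσk p hpU) v, hAv, hv] at h5
  simp only [map_zero, zero_add] at h5
  have h6 := maurerCartan_eq_zero h5.symm
  rw [h6, hv] at h4
  exact h4.trans (by simp only [map_zero, add_zero]; rfl)

end Horizontal

end PathConn

/-! ### Horizontal maps and their uniqueness -/

theorem HasMFDerivWithinAt.eventually_eq_of_zero {E' : Type*} [NormedAddCommGroup E']
    [NormedSpace ℝ E'] {E : Type*} [NormedAddCommGroup E] [NormedSpace ℝ E] {X : Type*}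
    [TopologicalSpace X] [ChartedSpace E X] [IsManifold 𝓘(ℝ, E) 1 X] {S : Set E'}
    (hS : Convex ℝ S) {k : E' → X} {x : E'} (hx : x ∈ S)
    (hk : ∀ᶠ y in 𝓝[S] x, HasMFDerivWithinAt 𝓘(ℝ, E') 𝓘(ℝ, E) k S y 0) :
    ∀ᶠ y in 𝓝[S] x, k y = k x := by
  have hc : ContinuousWithinAt k S x := (hk.self_of_nhdsWithin hx).continuousWithinAt
  have h1 : ∀ᶠ y in 𝓝[S] x, k y ∈ (chartAt E (k x)).source :=
    hc.eventually ((chartAt E (k x)).open_source.mem_nhds (mem_chart_source E (k x)))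
  obtain ⟨ε, hε, hsub⟩ := Metric.mem_nhdsWithin_iff.1 (hk.and h1)
  have hderiv : ∀ y ∈ ball x ε ∩ S,
      HasFDerivWithinAt (fun y => extChartAt 𝓘(ℝ, E) (k x) (k y)) (0 : E' →L[ℝ] E)
        (ball x ε ∩ S) y := by
    intro y hy
    obtain ⟨h2, h3⟩ := hsub hy
    have h4 := HasMFDerivAt.comp_hasMFDerivWithinAt y
      (mdifferentiableAt_extChartAt (I := 𝓘(ℝ, E)) h3).hasMFDerivAt h2
    rw [ContinuousLinearMap.comp_zero] at h4
    exact (hasMFDerivWithinAt_iff_hasFDerivWithinAt.1 h4).mono inter_subset_right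
  have hconst : ∀ y ∈ ball x ε ∩ S,
      extChartAt 𝓘(ℝ, E) (k x) (k y) = extChartAt 𝓘(ℝ, E) (k x) (k x) := by
    intro y hy
    have h5 := ((convex_ball x ε).inter hS).norm_image_sub_le_of_norm_hasFDerivWithin_le hderiv
      (C := 0) (fun y _ => by simp) ⟨mem_ball_self hε, hx⟩ hy
    rw [zero_mul] at h5
    exact sub_eq_zero.1 (norm_le_zero_iff.1 h5)
  have h6 : ∀ᶠ y in 𝓝[S] x, y ∈ ball x ε ∩ S :=
    inter_mem (mem_nhdsWithin_of_mem_nhds (ball_mem_nhds x hε)) self_mem_nhdsWithin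
  filter_upwards [h6] with y hy
  refine (extChartAt 𝓘(ℝ, E) (k x)).injOn ?_ ?_ (hconst y hy)
  · rw [extChartAt_source]; exact (hsub hy).2
  · exact mem_extChartAt_source (k x)

namespace PathConn

section HorizontalAt

variable {EG : Type*} [NormedAddCommGroup EG] [NormedSpace ℝ EG]
  {G : Type*} [TopologicalSpace G] [ChartedSpace EG G] [Group G]
  {EM : Type*} [NormedAddCommGroup EM] [NormedSpace ℝ EM]
  {M : Type*} [TopologicalSpace M] [ChartedSpace EM M]
  {EP : Type*} [NormedAddCommGroup EP] [NormedSpace ℝ EP]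
  {P : Type*} [TopologicalSpace P] [ChartedSpace EP P]
  {E' : Type*} [NormedAddCommGroup E'] [NormedSpace ℝ E']

/-- `F : S → P` is smooth at `x` and its derivative at `x` takes horizontal values. -/
structure IsHorizontalAt (A : ∀ p : P, TangentSpace 𝓘(ℝ, EP) p →L[ℝ] GroupLieAlgebra 𝓘(ℝ, EG) G)
    (S : Set E') (F : E' → P) (x : E') : Prop where
  smooth : ContMDiffWithinAt 𝓘(ℝ, E') 𝓘(ℝ, EP) ∞ F S x
  horizontal : ∀ ξ : E', A (F x) (mfderivWithin 𝓘(ℝ, E') 𝓘(ℝ, EP) F S x ξ) = 0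

variable {A : ∀ p : P, TangentSpace 𝓘(ℝ, EP) p →L[ℝ] GroupLieAlgebra 𝓘(ℝ, EG) G}
  {S : Set E'} {F F₁ F₂ : E' → P} {x : E'}

theorem IsHorizontalAt.hasMFDerivWithinAt (h : IsHorizontalAt A S F x) :
    HasMFDerivWithinAt 𝓘(ℝ, E') 𝓘(ℝ, EP) F S x (mfderivWithin 𝓘(ℝ, E') 𝓘(ℝ, EP) F S x) :=
  (h.smooth.mdifferentiableWithinAt (by simp)).hasMFDerivWithinAt

theorem IsHorizontalAt.of_hasMFDerivWithinAt (hS : UniqueDiffOn ℝ S) (hx : x ∈ S)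
    (hF : ContMDiffWithinAt 𝓘(ℝ, E') 𝓘(ℝ, EP) ∞ F S x)
    {F' : TangentSpace 𝓘(ℝ, E') x →L[ℝ] TangentSpace 𝓘(ℝ, EP) (F x)}
    (hF' : HasMFDerivWithinAt 𝓘(ℝ, E') 𝓘(ℝ, EP) F S x F')
    (h : ∀ ξ : E', A (F x) (F' ξ) = 0) : IsHorizontalAt A S F x := by
  refine ⟨hF, fun ξ => ?_⟩
  rw [hF'.mfderivWithin (hS.uniqueMDiffOn x hx)]
  exact h ξ

theorem IsHorizontalAt.congr (h : IsHorizontalAt A S F x) (hx : x ∈ S)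
    (he : F₁ =ᶠ[𝓝[S] x] F) : IsHorizontalAt A S F₁ x := by
  have hxe : F₁ x = F x := he.self_of_nhdsWithin hx
  refine ⟨h.smooth.congr_of_eventuallyEq he hxe, fun ξ => ?_⟩
  rw [he.mfderivWithin_eq hxe]
  exact (tangent_fun_congr (fun p v => A p v) hxe _).trans (h.horizontal ξ)

variable [IsManifold 𝓘(ℝ, EP) ∞ P] [LieGroup 𝓘(ℝ, EG) ∞ G] [MulAction Gᵐᵒᵖ P] {π : P → M}

theorem IsHorizontalAt.act (hA : IsConnectionForm A) (hπ : IsPrincipalBundle EG EM EP G π)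
    (hS : UniqueDiffOn ℝ S) (hx : x ∈ S) (h : IsHorizontalAt A S F x) (c : G) :
    IsHorizontalAt A S (fun y => F y <• c) x := by
  refine IsHorizontalAt.of_hasMFDerivWithinAt hS hx ?_ (hasMFDerivWithinAt_act hπ.smooth_act
    h.hasMFDerivWithinAt (hasMFDerivWithinAt_const c S x)) fun ξ => ?_
  · exact (hπ.smooth_act.contMDiffAt (x := (F x, c))).comp_contMDiffWithinAt x
      (f := fun y => (F y, c))
      (h.smooth.prodMk contMDiffWithinAt_const)
  · refine (hA.apply_act hπ.smooth_act (F x) c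
      (mfderivWithin 𝓘(ℝ, E') 𝓘(ℝ, EP) F S x ξ) 0).trans ?_
    rw [h.horizontal ξ, map_zero, map_zero, add_zero]

/-- Two horizontal lifts of the same map locally differ by a constant element of `G`. -/
theorem IsHorizontalAt.exists_eventually_eq_act (hA : IsConnectionForm A)
    (hπ : IsPrincipalBundle EG EM EP G π) (hS : Convex ℝ S) (hSu : UniqueDiffOn ℝ S) (hx : x ∈ S)
    (h₁ : ∀ᶠ y in 𝓝[S] x, IsHorizontalAt A S F₁ y) (h₂ : ∀ᶠ y in 𝓝[S] x, IsHorizontalAt A S F₂ y)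
    (he : ∀ᶠ y in 𝓝[S] x, π (F₁ y) = π (F₂ y)) :
    ∃ c : G, ∀ᶠ y in 𝓝[S] x, F₂ y = F₁ y <• c := by
  have : IsManifold 𝓘(ℝ, EG) 1 G := IsManifold.of_le (n := ∞) (by simp)
  obtain ⟨U, hU, hxU, σ, k, hσ, hk, hσk, -⟩ := hπ.exists_section (π (F₁ x))
  have hUo : IsOpen (π ⁻¹' U) := hU.preimage hπ.smooth_proj.continuous
  have hxe : π (F₁ x) = π (F₂ x) := he.self_of_nhdsWithin hx
  have hU₁ : ∀ᶠ y in 𝓝[S] x, F₁ y ∈ π ⁻¹' U :=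
    (h₁.self_of_nhdsWithin hx).smooth.continuousWithinAt.eventually (hUo.mem_nhds hxU)
  have hU₂ : ∀ᶠ y in 𝓝[S] x, F₂ y ∈ π ⁻¹' U :=
    (h₂.self_of_nhdsWithin hx).smooth.continuousWithinAt.eventually
      (hUo.mem_nhds (by rw [mem_preimage, ← hxe]; exact hxU))
  -- The smooth function with `F₂ = F₁ <• κ`. As both maps are horizontal, the gauge rule leaves
  -- `κ⁻¹ dκ = 0`, so `κ` is locally constant.
  let κ : E' → G := fun y => (k (F₁ y))⁻¹ * k (F₂ y)
  have hκ : ∀ᶠ y in 𝓝[S] x, F₂ y = F₁ y <• κ y := by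
    filter_upwards [hU₁, hU₂, he] with y hy₁ hy₂ hye
    have e₁ := hσk _ hy₁
    have e₂ := hσk _ hy₂
    calc F₂ y = σ (π (F₁ y)) <• k (F₂ y) := by rw [hye, e₂]
      _ = (σ (π (F₁ y)) <• k (F₁ y)) <• κ y := by
          simp only [κ, smul_smul, ← MulOpposite.op_mul, mul_inv_cancel_left]
      _ = F₁ y <• κ y := by rw [e₁]
  refine ⟨κ x, ?_⟩
  have hconst : ∀ᶠ y in 𝓝[S] x, κ y = κ x := by
    refine HasMFDerivWithinAt.eventually_eq_of_zero (E := EG) hS hx ?_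
    filter_upwards [h₁, h₂, hU₁, hU₂, eventually_eventually_nhdsWithin.2 hκ,
      self_mem_nhdsWithin] with y hy₁ hy₂ hyU₁ hyU₂ hyκ hyS
    have hd : MDifferentiableWithinAt 𝓘(ℝ, E') 𝓘(ℝ, EG) κ S y := by
      have e₁ : ContMDiffWithinAt 𝓘(ℝ, E') 𝓘(ℝ, EG) ∞ (fun y => k (F₁ y)) S y :=
        (hk.contMDiffAt (hUo.mem_nhds hyU₁)).comp_contMDiffWithinAt y hy₁.smooth
      have e₂ : ContMDiffWithinAt 𝓘(ℝ, E') 𝓘(ℝ, EG) ∞ (fun y => k (F₂ y)) S y :=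
        (hk.contMDiffAt (hUo.mem_nhds hyU₂)).comp_contMDiffWithinAt y hy₂.smooth
      exact (e₁.inv.mul e₂).mdifferentiableWithinAt (by simp)
    have hd' := hd.hasMFDerivWithinAt
    have e₃ := (hasMFDerivWithinAt_act hπ.smooth_act hy₁.hasMFDerivWithinAt
      hd').congr_of_eventuallyEq hyκ (hyκ.self_of_nhdsWithin hyS)
    have e₄ := e₃.mfderivWithin (hSu.uniqueMDiffOn y hyS)
    suffices hzero : mfderivWithin 𝓘(ℝ, E') 𝓘(ℝ, EG) κ S y = 0 by rwa [hzero] at hd'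
    ext ξ
    have e₅ := hy₂.horizontal ξ
    rw [e₄] at e₅
    have e₆ := hA.apply_act hπ.smooth_act (F₁ y) (κ y)
      (mfderivWithin 𝓘(ℝ, E') 𝓘(ℝ, EP) F₁ S y ξ) (mfderivWithin 𝓘(ℝ, E') 𝓘(ℝ, EG) κ S y ξ)
    have e₇ := (tangent_fun_congr (fun p v => A p v) (hyκ.self_of_nhdsWithin hyS) _).symm.trans e₅
    have e₈ := e₆.symm.trans e₇
    rw [hy₁.horizontal ξ, map_zero, zero_add] at e₈
    exact maurerCartan_eq_zero e₈
  filter_upwards [hκ, hconst] with y hy hyc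
  rw [hy, hyc]

/-- Horizontal lifts of the same map over a connected set agree if they agree at a point. -/
theorem IsHorizontalAt.eqOn (hA : IsConnectionForm A)
    (hπ : IsPrincipalBundle EG EM EP G π) (hS : Convex ℝ S) (hSu : UniqueDiffOn ℝ S) {W : Set E'}
    (hW : IsOpen W) (hWc : Convex ℝ W)
    (h₁ : ∀ y ∈ S ∩ W, IsHorizontalAt A S F₁ y) (h₂ : ∀ y ∈ S ∩ W, IsHorizontalAt A S F₂ y)
    (he : ∀ y ∈ S ∩ W, π (F₁ y) = π (F₂ y)) (hx : x ∈ S ∩ W) (hxe : F₁ x = F₂ x) :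
    EqOn F₁ F₂ (S ∩ W) := by
  intro y hy
  -- Agreement at a point is a locally constant property: locally `F₂ = F₁ <• c`, and by freeness of
  -- the action the two agree at a point exactly when `c = 1`.
  refine ((hS.inter hWc).isPreconnected.induction₂ (fun x y => F₁ x = F₂ x ↔ F₁ y = F₂ y)
    (fun z hz => ?_) (fun _ _ _ _ _ _ => Iff.trans) (fun _ _ _ _ => Iff.symm) hx hy).1 hxe
  have hW' : ∀ᶠ y in 𝓝[S] z, y ∈ S ∩ W := inter_mem self_mem_nhdsWithin
    (mem_nhdsWithin_of_mem_nhds (hW.mem_nhds hz.2))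
  obtain ⟨c, hc⟩ := IsHorizontalAt.exists_eventually_eq_act hA hπ hS hSu hz.1
    (hW'.mono h₁) (hW'.mono h₂) (hW'.mono he)
  have hiff : ∀ y, F₂ y = F₁ y <• c → (F₁ y = F₂ y ↔ c = 1) := by
    intro y hy
    rw [hy]
    refine ⟨fun h => hπ.free _ _ h.symm, fun h => ?_⟩
    rw [h, MulOpposite.op_one, one_smul]
  filter_upwards [nhdsWithin_mono z inter_subset_left hc] with y hy
  rw [hiff z (hc.self_of_nhdsWithin hz.1), hiff y hy]

end HorizontalAt

/-! ### The connection form in a chart -/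

section ChartForm

variable {EG : Type*} [NormedAddCommGroup EG] [NormedSpace ℝ EG]
  {G : Type*} [TopologicalSpace G] [ChartedSpace EG G] [Group G]
  {EP : Type*} [NormedAddCommGroup EP] [NormedSpace ℝ EP]
  {P : Type*} [TopologicalSpace P] [ChartedSpace EP P]

/-- The expression of an `L(G)`-valued 1-form in the chart at `p₀`. -/
noncomputable def chartForm
    (A : ∀ p : P, TangentSpace 𝓘(ℝ, EP) p →L[ℝ] GroupLieAlgebra 𝓘(ℝ, EG) G) (p₀ : P) (e : EP) :
    EP →L[ℝ] EG :=
  (A ((extChartAt 𝓘(ℝ, EP) p₀).symm e)).comp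
    (mfderivWithin 𝓘(ℝ, EP) 𝓘(ℝ, EP) (extChartAt 𝓘(ℝ, EP) p₀).symm (extChartAt 𝓘(ℝ, EP) p₀).target e)

variable [IsManifold 𝓘(ℝ, EP) ∞ P]
  {A : ∀ p : P, TangentSpace 𝓘(ℝ, EP) p →L[ℝ] GroupLieAlgebra 𝓘(ℝ, EG) G}

theorem IsConnectionForm.contDiffOn_chartForm [FiniteDimensional ℝ EP] [MulAction Gᵐᵒᵖ P]
    (hA : IsConnectionForm A)
    (p₀ : P) : ContDiffOn ℝ ∞ (chartForm A p₀) (extChartAt 𝓘(ℝ, EP) p₀).target := by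
  have : IsManifold 𝓘(ℝ, EP) 1 P := IsManifold.of_le (n := ∞) (by simp)
  -- In finite dimension smoothness of an operator-valued map can be tested on each fixed vector
  -- `w`; there it is the pairing of the smooth section `A` with the smooth field obtained by
  -- pushing `w` forward along the inverse chart.
  rw [contDiffOn_clm_apply]
  intro w
  set ψ := extChartAt 𝓘(ℝ, EP) p₀ with hψ
  have hsymm : ContMDiffOn 𝓘(ℝ, EP) 𝓘(ℝ, EP) ∞ ψ.symm ψ.target := contMDiffOn_extChartAt_symm p₀
  have hopen : IsOpen ψ.target := isOpen_extChartAt_target p₀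
  have h1 := hsymm.contMDiffOn_tangentMapWithin (m := ∞) (by simp) hopen.uniqueMDiffOn
  have h2 : ContMDiffOn 𝓘(ℝ, EP) 𝓘(ℝ, EP).tangent ∞
      (fun e : EP => (⟨e, w⟩ : TangentBundle 𝓘(ℝ, EP) EP)) ψ.target :=
    contMDiffOn_vectorSpace_iff_contDiffOn.2 contDiffOn_const
  have h3 := h1.comp h2 (fun e he => he)
  have h4 : ContMDiffOn 𝓘(ℝ, EP) (𝓘(ℝ, EP).prod 𝓘(ℝ, EP →L[ℝ] EG)) ∞
      (fun e => Bundle.TotalSpace.mk' (EP →L[ℝ] EG)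
        (E := fun p : P => TangentSpace 𝓘(ℝ, EP) p →L[ℝ] Bundle.Trivial P EG p)
        (ψ.symm e) (A (ψ.symm e))) ψ.target := hA.smooth.comp_contMDiffOn hsymm
  have h5 := ContMDiffOn.clm_bundle_apply (E₁ := fun p : P => TangentSpace 𝓘(ℝ, EP) p)
    (E₂ := Bundle.Trivial P EG) (b := ψ.symm)
    (v := fun e => mfderivWithin 𝓘(ℝ, EP) 𝓘(ℝ, EP) ψ.symm ψ.target e w) h4 h3
  rw [← contMDiffOn_iff_contDiffOn]
  exact fun e he => (Bundle.contMDiffWithinAt_totalSpace.1 (h5 e he)).2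

/-- Near `x` the map `F` is the inverse chart composed with its own chart expression, so the chain
rule translates horizontality into the vector-space setting of `exists_graph_tangent_ker`. -/
theorem chartForm_fderivWithin {E' : Type*} [NormedAddCommGroup E'] [NormedSpace ℝ E'] {S : Set E'}
    (hSu : UniqueDiffOn ℝ S) {F : E' → P} {x : E'} (hx : x ∈ S)
    (hF : MDifferentiableWithinAt 𝓘(ℝ, E') 𝓘(ℝ, EP) F S x) {p₀ : P}
    (hp₀ : F x ∈ (extChartAt 𝓘(ℝ, EP) p₀).source) (ξ : E') :
    chartForm A p₀ (extChartAt 𝓘(ℝ, EP) p₀ (F x))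
      (fderivWithin ℝ (fun y => extChartAt 𝓘(ℝ, EP) p₀ (F y)) S x ξ) =
    A (F x) (mfderivWithin 𝓘(ℝ, E') 𝓘(ℝ, EP) F S x ξ) := by
  have : IsManifold 𝓘(ℝ, EP) 1 P := IsManifold.of_le (n := ∞) (by simp)
  set ψ := extChartAt 𝓘(ℝ, EP) p₀ with hψ
  have hopen : IsOpen ψ.target := isOpen_extChartAt_target p₀
  have ht : ψ (F x) ∈ ψ.target := ψ.map_source hp₀
  have h1 : HasMFDerivWithinAt 𝓘(ℝ, E') 𝓘(ℝ, EP) (fun y => ψ (F y)) S x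
      (mfderivWithin 𝓘(ℝ, E') 𝓘(ℝ, EP) (fun y => ψ (F y)) S x) := by
    have hd : MDifferentiableAt 𝓘(ℝ, EP) 𝓘(ℝ, EP) ψ (F x) :=
      mdifferentiableAt_extChartAt (by rwa [← extChartAt_source 𝓘(ℝ, EP)])
    exact (hd.comp_mdifferentiableWithinAt x hF).hasMFDerivWithinAt
  have h2 : HasMFDerivAt 𝓘(ℝ, EP) 𝓘(ℝ, EP) ψ.symm (ψ (F x))
      (mfderivWithin 𝓘(ℝ, EP) 𝓘(ℝ, EP) ψ.symm ψ.target (ψ (F x))) := by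
    have h3 : ContMDiffOn 𝓘(ℝ, EP) 𝓘(ℝ, EP) ∞ ψ.symm ψ.target := contMDiffOn_extChartAt_symm p₀
    exact ((h3 _ ht).mdifferentiableWithinAt (by simp)).hasMFDerivWithinAt.hasMFDerivAt
      (hopen.mem_nhds ht)
  have h3 := HasMFDerivAt.comp_hasMFDerivWithinAt x h2 h1
  have he : F =ᶠ[𝓝[S] x] ψ.symm ∘ fun y => ψ (F y) := by
    filter_upwards [hF.continuousWithinAt.eventually
      ((isOpen_extChartAt_source p₀).mem_nhds hp₀)] with y hy
    exact (ψ.left_inv hy).symm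
  have hxe : ψ.symm (ψ (F x)) = F x := ψ.left_inv hp₀
  have h4 := h3.congr_of_eventuallyEq he hxe.symm
  rw [h4.mfderivWithin (hSu.uniqueMDiffOn x hx), ← mfderivWithin_eq_fderivWithin]
  exact (tangent_fun_congr (fun p v => A p v) hxe _)

end ChartForm

/-! ### Local existence of horizontal lifts -/

section LocalExistence

variable {EG : Type*} [NormedAddCommGroup EG] [NormedSpace ℝ EG]
  {G : Type*} [TopologicalSpace G] [ChartedSpace EG G] [Group G] [LieGroup 𝓘(ℝ, EG) ∞ G]
  {EM : Type*} [NormedAddCommGroup EM] [NormedSpace ℝ EM]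
  {M : Type*} [TopologicalSpace M] [ChartedSpace EM M]
  {EP : Type*} [NormedAddCommGroup EP] [NormedSpace ℝ EP]
  {P : Type*} [TopologicalSpace P] [ChartedSpace EP P]
  [MulAction Gᵐᵒᵖ P]
  {E' : Type*} [NormedAddCommGroup E'] [NormedSpace ℝ E']
  {A : ∀ p : P, TangentSpace 𝓘(ℝ, EP) p →L[ℝ] GroupLieAlgebra 𝓘(ℝ, EG) G} {π : P → M}

/-- The map `(x, y) ↦ σ (Γ x) χ⁻¹(y)` where `χ` is the chart of `G` at `1`. -/
noncomputable def sectionMul (σΓ : E' → P) (z : E' × EG) : P :=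
  σΓ z.1 <• (extChartAt 𝓘(ℝ, EG) (1 : G)).symm z.2

theorem contMDiffOn_sectionMul (hπ : IsPrincipalBundle EG EM EP G π) {S : Set E'} {s : E' → P}
    (hs : ContMDiffOn 𝓘(ℝ, E') 𝓘(ℝ, EP) ∞ s S) {V : Set EG}
    (hV : V ⊆ (extChartAt 𝓘(ℝ, EG) (1 : G)).target) :
    ContMDiffOn 𝓘(ℝ, E' × EG) 𝓘(ℝ, EP) ∞ (sectionMul (G := G) s) (S ×ˢ V) := by
  have h1 : ContMDiffOn 𝓘(ℝ, E' × EG) 𝓘(ℝ, EP) ∞ (fun z : E' × EG => s z.1) (S ×ˢ V) :=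
    hs.comp (contDiff_fst.contMDiff.contMDiffOn) fun z hz => hz.1
  have h2 : ContMDiffOn 𝓘(ℝ, E' × EG) 𝓘(ℝ, EG) ∞
      (fun z : E' × EG => (extChartAt 𝓘(ℝ, EG) (1 : G)).symm z.2) (S ×ˢ V) :=
    (contMDiffOn_extChartAt_symm (1 : G)).comp (contDiff_snd.contMDiff.contMDiffOn)
      fun z hz => hV hz.2
  exact hπ.smooth_act.comp_contMDiffOn (h1.prodMk h2)

variable [IsManifold 𝓘(ℝ, EP) ∞ P]

/-- The connection form is nondegenerate along the fibre directions of `sectionMul`. -/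
theorem IsConnectionForm.eq_zero_of_sectionMul (hA : IsConnectionForm A)
    (hπ : IsPrincipalBundle EG EM EP G π) {S : Set E'} (hSu : UniqueDiffOn ℝ S) {s : E' → P}
    (hs : ContMDiffOn 𝓘(ℝ, E') 𝓘(ℝ, EP) ∞ s S) {V : Set EG} (hVo : IsOpen V)
    (hV : V ⊆ (extChartAt 𝓘(ℝ, EG) (1 : G)).target) {x : E'} (hx : x ∈ S) {y : EG} (hy : y ∈ V)
    {ζ : EG} (h : A (sectionMul (G := G) s (x, y))
      (mfderivWithin 𝓘(ℝ, E' × EG) 𝓘(ℝ, EP) (sectionMul (G := G) s) (S ×ˢ V) (x, y) ((0, ζ) : E' × EG)) = 0) :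
    ζ = 0 := by
  have : IsManifold 𝓘(ℝ, EG) 1 G := IsManifold.of_le (n := ∞) (by simp)
  set χ := extChartAt 𝓘(ℝ, EG) (1 : G) with hχ
  have hsd : HasMFDerivWithinAt 𝓘(ℝ, E') 𝓘(ℝ, EP) s S x (mfderivWithin 𝓘(ℝ, E') 𝓘(ℝ, EP) s S x) :=
    ((hs x hx).mdifferentiableWithinAt (by simp)).hasMFDerivWithinAt
  have hopen : IsOpen χ.target := isOpen_extChartAt_target 1
  have hχd : HasMFDerivAt 𝓘(ℝ, EG) 𝓘(ℝ, EG) χ.symm y (mfderiv 𝓘(ℝ, EG) 𝓘(ℝ, EG) χ.symm y) :=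
    (((contMDiffOn_extChartAt_symm (I := 𝓘(ℝ, EG)) (n := ∞) (1 : G)).contMDiffAt
      (hopen.mem_nhds (hV hy))).mdifferentiableAt (by simp)).hasMFDerivAt
  have hfst : HasMFDerivWithinAt 𝓘(ℝ, E' × EG) 𝓘(ℝ, E') (Prod.fst : E' × EG → E') (S ×ˢ V) (x, y)
      (ContinuousLinearMap.fst ℝ E' EG) := hasFDerivWithinAt_fst.hasMFDerivWithinAt
  have hsnd : HasMFDerivWithinAt 𝓘(ℝ, E' × EG) 𝓘(ℝ, EG) (Prod.snd : E' × EG → EG) (S ×ˢ V) (x, y)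
      (ContinuousLinearMap.snd ℝ E' EG) := hasFDerivWithinAt_snd.hasMFDerivWithinAt
  have h1 := HasMFDerivWithinAt.comp (x, y) hsd hfst (fun z hz => hz.1)
  have h2 := HasMFDerivAt.comp_hasMFDerivWithinAt (x, y) hχd hsnd
  have h3 := hasMFDerivWithinAt_act hπ.smooth_act h1 h2
  have hu : UniqueMDiffWithinAt 𝓘(ℝ, E' × EG) (S ×ˢ V) (x, y) :=
    (hSu.prod hVo.uniqueDiffOn).uniqueMDiffOn _ ⟨hx, hy⟩
  have h4 := h3.mfderivWithin hu
  have h5 : A (s x) (mfderivWithin 𝓘(ℝ, E') 𝓘(ℝ, EP) s S x 0) = 0 :=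
    (congrArg (A (s x)) (map_zero _)).trans (map_zero _)
  -- In the direction `(0, ζ)` the factor `s` does not move, so only the Maurer–Cartan term of the
  -- gauge rule is left.
  have h6 : maurerCartan (χ.symm y) (mfderiv 𝓘(ℝ, EG) 𝓘(ℝ, EG) χ.symm y ζ) = 0 :=
    (hA.apply_act_of_eq_zero hπ.smooth_act (χ.symm y) h5 _).symm.trans
      ((congrArg (fun L : E' × EG →L[ℝ] EP =>
        A (sectionMul (G := G) s (x, y)) (L (0, ζ))) h4).symm.trans h)
  have h7 := maurerCartan_eq_zero h6
  have hχs : χ.symm y ∈ χ.source := χ.map_target (hV hy)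
  have h8 := HasMFDerivAt.comp y (mdifferentiableAt_extChartAt (I := 𝓘(ℝ, EG)) (x := (1 : G))
    (by rwa [← extChartAt_source 𝓘(ℝ, EG)])).hasMFDerivAt hχd
  have h9 := h8.congr_of_eventuallyEq (f₁ := id) (by
    filter_upwards [hopen.mem_nhds (hV hy)] with y hy
    exact (χ.right_inv hy).symm)
  have h10 := hasMFDerivAt_unique (hasMFDerivAt_id y) h9
  have h11 := congrArg (fun L : EG →L[ℝ] EG => L ζ) h10
  refine h11.trans ?_
  exact (congrArg (mfderiv 𝓘(ℝ, EG) 𝓘(ℝ, EG) χ (χ.symm y)) h7).trans (map_zero _)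

/-- Local existence of horizontal lifts of maps of rank at most one. -/
theorem IsConnectionForm.exists_local_lift [FiniteDimensional ℝ EG] [FiniteDimensional ℝ EP]
    (hA : IsConnectionForm A)
    (hπ : IsPrincipalBundle EG EM EP G π) {S : Set E'} (hS : Convex ℝ S)
    (hSi : (interior S).Nonempty) {Γ : E' → M} (hΓ : ContMDiffOn 𝓘(ℝ, E') 𝓘(ℝ, EM) ∞ Γ S)
    (hrank : ∀ x ∈ S, ∀ ξ ξ' : E', ∃ a b : ℝ, (a ≠ 0 ∨ b ≠ 0) ∧
      mfderivWithin 𝓘(ℝ, E') 𝓘(ℝ, EM) Γ S x (a • ξ + b • ξ' : E') = 0) {x₀ : E'} (hx₀ : x₀ ∈ S) :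
    ∃ F : E' → P, ∃ ρ > 0, ∀ x ∈ S ∩ ball x₀ ρ, IsHorizontalAt A S F x ∧ π (F x) = Γ x := by
  have : IsManifold 𝓘(ℝ, EP) 1 P := IsManifold.of_le (n := ∞) (by simp)
  set χ := extChartAt 𝓘(ℝ, EG) (1 : G) with hχ
  have hχo : IsOpen χ.target := isOpen_extChartAt_target 1
  have hy₀ : χ 1 ∈ χ.target := mem_extChartAt_target 1
  obtain ⟨U, hU, hxU, σ, -, hσ, -, -, hπσ⟩ := hπ.exists_section (Γ x₀)
  have hΓU : ∀ᶠ x in 𝓝[S] x₀, Γ x ∈ U :=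
    (hΓ x₀ hx₀).continuousWithinAt.eventually (hU.mem_nhds hxU)
  obtain ⟨δ, hδ, hδU⟩ := Metric.mem_nhdsWithin_iff.1 hΓU
  let s : E' → P := fun x => σ (Γ x)
  have hs : ContMDiffOn 𝓘(ℝ, E') 𝓘(ℝ, EP) ∞ s (S ∩ ball x₀ δ) :=
    hσ.comp (hΓ.mono inter_subset_left) fun x hx => hδU ⟨hx.2, hx.1⟩
  -- A lift of `Γ` is sought as `Ψ (x, g x)` with `g x₀` the coordinate of the identity, so that it
  -- passes through `σ (Γ x₀)` at `x₀`.
  let Ψ : E' × EG → P := sectionMul (G := G) s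
  have hΨ : ContMDiffOn 𝓘(ℝ, E' × EG) 𝓘(ℝ, EP) ∞ Ψ ((S ∩ ball x₀ δ) ×ˢ χ.target) :=
    contMDiffOn_sectionMul hπ hs subset_rfl
  have hz₀ : (x₀, χ 1) ∈ (S ∩ ball x₀ δ) ×ˢ χ.target := ⟨⟨hx₀, mem_ball_self hδ⟩, hy₀⟩
  set ψ := extChartAt 𝓘(ℝ, EP) (Ψ (x₀, χ 1)) with hψ
  have hψo : IsOpen ψ.target := isOpen_extChartAt_target _
  have hΨψ : ∀ᶠ z in 𝓝[(S ∩ ball x₀ δ) ×ˢ χ.target] (x₀, χ 1), Ψ z ∈ ψ.source :=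
    (hΨ _ hz₀).continuousWithinAt.eventually
      ((isOpen_extChartAt_source _).mem_nhds (mem_extChartAt_source _))
  obtain ⟨ε, hε, hεψ⟩ := Metric.mem_nhdsWithin_iff.1 hΨψ
  set T := (S ∩ ball x₀ δ) ∩ ball x₀ ε with hT
  set V := χ.target ∩ ball (χ 1) ε with hV
  have hsub : T ×ˢ V ⊆ (S ∩ ball x₀ δ) ×ˢ χ.target := prod_mono inter_subset_left inter_subset_left
  have hTS : T ⊆ S := inter_subset_left.trans inter_subset_left
  have hTc : Convex ℝ T := (hS.inter (convex_ball _ _)).inter (convex_ball _ _)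
  have hTx₀ : x₀ ∈ T := ⟨⟨hx₀, mem_ball_self hδ⟩, mem_ball_self hε⟩
  have hTi : (interior T).Nonempty := by
    rw [hT, inter_assoc, interior_inter, (isOpen_ball.inter isOpen_ball).interior_eq]
    have h1 : x₀ ∈ closure (interior S) :=
      (hS.closure_interior_eq_closure_of_nonempty_interior hSi).symm ▸ subset_closure hx₀
    rw [inter_comm]
    exact mem_closure_iff.1 h1 _ (isOpen_ball.inter isOpen_ball)
      ⟨mem_ball_self hδ, mem_ball_self hε⟩
  have hVo : IsOpen V := hχo.inter isOpen_ball
  have hTu : UniqueDiffOn ℝ T := uniqueDiffOn_convex hTc hTi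
  have hDu : UniqueDiffOn ℝ (T ×ˢ V) := hTu.prod hVo.uniqueDiffOn
  have hTn : ∀ x ∈ T, T ∈ 𝓝[S] x := by
    intro x hx
    rw [hT, inter_assoc]
    exact inter_mem_nhdsWithin S ((isOpen_ball.inter isOpen_ball).mem_nhds ⟨hx.1.2, hx.2⟩)
  have hmaps : ∀ z ∈ T ×ˢ V, Ψ z ∈ ψ.source := by
    rintro z hz
    refine hεψ ⟨?_, hsub hz⟩
    rw [← ball_prod_same]
    exact ⟨hz.1.2, hz.2.2⟩
  replace hs := hs.mono (inter_subset_left : T ⊆ S ∩ ball x₀ δ)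
  replace hΨ := hΨ.mono hsub
  have hΨd : ∀ z ∈ T ×ˢ V, MDifferentiableWithinAt 𝓘(ℝ, E' × EG) 𝓘(ℝ, EP) Ψ (T ×ˢ V) z :=
    fun z hz => (hΨ z hz).mdifferentiableWithinAt (by simp)
  have hπΨ : ∀ z ∈ T ×ˢ V, π (Ψ z) = Γ z.1 := fun z hz => by
    simp only [Ψ, sectionMul, hπ.proj_act, s]
    exact hπσ _ (hδU ⟨hz.1.1.2, hz.1.1.1⟩)
  have hψΨ : ContDiffOn ℝ ∞ (fun z => ψ (Ψ z)) (T ×ˢ V) := by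
    rw [← contMDiffOn_iff_contDiffOn]
    refine (contMDiffOn_extChartAt (I := 𝓘(ℝ, EP)) (n := ∞)).comp hΨ fun z hz => ?_
    rw [← extChartAt_source 𝓘(ℝ, EP)]
    exact hmaps z hz
  have hform : ∀ z ∈ T ×ˢ V, ∀ w, chartForm A (Ψ (x₀, χ 1)) (ψ (Ψ z))
      (fderivWithin ℝ (fun z => ψ (Ψ z)) (T ×ˢ V) z w) =
      A (Ψ z) (mfderivWithin 𝓘(ℝ, E' × EG) 𝓘(ℝ, EP) Ψ (T ×ˢ V) z w) := fun z hz w =>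
    chartForm_fderivWithin hDu hz (hΨd z hz) (hmaps z hz) w
  have hproj : ∀ z ∈ T ×ˢ V, ∀ w : E' × EG, mfderiv 𝓘(ℝ, EP) 𝓘(ℝ, EM) π (Ψ z)
      (mfderivWithin 𝓘(ℝ, E' × EG) 𝓘(ℝ, EP) Ψ (T ×ˢ V) z w) =
      (mfderivWithin 𝓘(ℝ, E') 𝓘(ℝ, EM) Γ S z.1 w.1 : EM) := by
    intro z hz w
    have h1 := HasMFDerivAt.comp_hasMFDerivWithinAt z
      (hπ.smooth_proj.mdifferentiable (by simp) (Ψ z)).hasMFDerivAt (hΨd z hz).hasMFDerivWithinAt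
    have h2 := HasMFDerivWithinAt.comp z (u := S) (f := (Prod.fst : E' × EG → E'))
      ((hΓ z.1 (hTS hz.1)).mdifferentiableWithinAt (by simp)).hasMFDerivWithinAt
      (hasFDerivWithinAt_fst.hasMFDerivWithinAt (s := T ×ˢ V)) (fun z hz => hTS hz.1)
    have h3 := h2.congr_of_eventuallyEq (f₁ := π ∘ Ψ)
      (by filter_upwards [self_mem_nhdsWithin] with z hz using hπΨ z hz) (hπΨ z hz)
    have h4 := (hDu.uniqueMDiffOn z hz).eq h1 h3
    exact congrArg (fun L : E' × EG →L[ℝ] EM => L w) h4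
  -- The rank condition: some nontrivial combination of `w` and `w'` is sent by `Ψ` to a vertical
  -- vector. It is also horizontal, hence zero, so the images are dependent.
  have hdep : ∀ z ∈ T ×ˢ V, ∀ w w',
      chartForm A (Ψ (x₀, χ 1)) (ψ (Ψ z)) (fderivWithin ℝ (fun z => ψ (Ψ z)) (T ×ˢ V) z w) = 0 →
      chartForm A (Ψ (x₀, χ 1)) (ψ (Ψ z)) (fderivWithin ℝ (fun z => ψ (Ψ z)) (T ×ˢ V) z w') = 0 →
      ¬ LinearIndependent ℝ ![fderivWithin ℝ (fun z => ψ (Ψ z)) (T ×ˢ V) z w,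
        fderivWithin ℝ (fun z => ψ (Ψ z)) (T ×ˢ V) z w'] := by
    intro z hz w w' hw hw'
    obtain ⟨a, b, hab, h0⟩ := hrank z.1 (hTS hz.1) w.1 w'.1
    have h1 : mfderivWithin 𝓘(ℝ, E' × EG) 𝓘(ℝ, EP) Ψ (T ×ˢ V) z (a • w + b • w' : E' × EG) = 0 := by
      refine hA.eq_zero_of_vertical hπ ((hproj z hz (a • w + b • w')).trans h0) ?_
      rw [← hform z hz, map_add, map_smul, map_smul, map_add, map_smul, map_smul, hw, hw']
      simp only [smul_zero, add_zero]
      rfl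
    have h2 : fderivWithin ℝ (fun z => ψ (Ψ z)) (T ×ˢ V) z (a • w + b • w') = 0 := by
      have hd : MDifferentiableAt 𝓘(ℝ, EP) 𝓘(ℝ, EP) ψ (Ψ z) :=
        mdifferentiableAt_extChartAt (by rw [← extChartAt_source 𝓘(ℝ, EP)]; exact hmaps z hz)
      have h3 := HasMFDerivAt.comp_hasMFDerivWithinAt z hd.hasMFDerivAt
        (hΨd z hz).hasMFDerivWithinAt
      have h4 := h3.mfderivWithin (hDu.uniqueMDiffOn z hz)
      rw [mfderivWithin_eq_fderivWithin] at h4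
      have h5 := congrArg (fun L : E' × EG →L[ℝ] EP => L (a • w + b • w')) h4
      refine h5.trans ?_
      exact (congrArg (mfderiv 𝓘(ℝ, EP) 𝓘(ℝ, EP) ψ (Ψ z)) h1).trans (map_zero _)
    rw [LinearIndependent.pair_iff]
    intro hli
    have h3 := hli a b (by rw [← map_smul, ← map_smul, ← map_add]; exact h2)
    rcases hab with h | h
    exacts [h h3.1, h h3.2]
  obtain ⟨g, g', ρ, hρ, hg0, hgV, hgd, hgk, hgs⟩ := exists_graph_tangent_ker hTc hTi hVo hψΨ hψo
    (hA.contDiffOn_chartForm (Ψ (x₀, χ 1))) (fun z hz => ψ.map_source (hmaps z hz)) hdep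
    hTx₀ (y₀ := χ 1) ⟨hy₀, mem_ball_self hε⟩ (fun ζ hζ => by
      rw [hform _ ⟨hTx₀, hy₀, mem_ball_self hε⟩] at hζ
      exact hA.eq_zero_of_sectionMul hπ hTu hs hVo inter_subset_left hTx₀
        ⟨hy₀, mem_ball_self hε⟩ hζ)
  refine ⟨fun x => Ψ (x, g x), min (min δ ε) ρ, by positivity, fun x hx => ?_⟩
  have hxT : x ∈ T ∩ ball x₀ ρ :=
    ⟨⟨⟨hx.1, ball_subset_ball ((min_le_left _ _).trans (min_le_left _ _)) hx.2⟩,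
      ball_subset_ball ((min_le_left _ _).trans (min_le_right _ _)) hx.2⟩,
      ball_subset_ball (min_le_right _ _) hx.2⟩
  have hTρ : T ∩ ball x₀ ρ ∈ 𝓝[S] x :=
    inter_mem (hTn x hxT.1) (mem_nhdsWithin_of_mem_nhds (isOpen_ball.mem_nhds hxT.2))
  have hxD : (x, g x) ∈ T ×ˢ V := ⟨hxT.1, hgV x hxT⟩
  refine ⟨?_, hπΨ _ hxD⟩
  refine IsHorizontalAt.of_hasMFDerivWithinAt (uniqueDiffOn_convex hS hSi) hx.1 ?_
    (F' := (mfderivWithin 𝓘(ℝ, E' × EG) 𝓘(ℝ, EP) Ψ (T ×ˢ V) (x, g x)).comp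
      ((ContinuousLinearMap.id ℝ E').prod (g' x))) ?_ fun ξ => ?_
  · refine ContMDiffWithinAt.mono_of_mem_nhdsWithin ?_ hTρ
    have hgr : ContMDiffOn 𝓘(ℝ, E') 𝓘(ℝ, E' × EG) ∞ (fun x => (x, g x)) (T ∩ ball x₀ ρ) :=
      (contDiffOn_id.prodMk hgs).contMDiffOn
    exact (hΨ.comp hgr fun y hy => ⟨hy.1, hgV y hy⟩) x hxT
  · refine HasMFDerivWithinAt.mono_of_mem_nhdsWithin ?_ hTρ
    have hgr : HasMFDerivWithinAt 𝓘(ℝ, E') 𝓘(ℝ, E' × EG) (fun x => (x, g x)) (T ∩ ball x₀ ρ) x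
        ((ContinuousLinearMap.id ℝ E').prod (g' x)) :=
      ((hasFDerivWithinAt_id x _).prodMk
        ((hgd x hxT).mono inter_subset_left)).hasMFDerivWithinAt
    exact HasMFDerivWithinAt.comp x (u := T ×ˢ V) (f := fun x => (x, g x))
      (hΨd _ hxD).hasMFDerivWithinAt hgr fun y hy => ⟨hy.1, hgV y hy⟩
  · exact (hform _ hxD (ξ, g' x ξ)).symm.trans (hgk x hxT ξ)

end LocalExistence

end PathConn

/-- A property of intervals that holds locally and can be glued holds on a compact interval. -/
theorem exists_of_local_of_glue {a b : ℝ} (hab : a ≤ b) {Q : ℝ → ℝ → Prop}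
    (hloc : ∀ x ∈ Icc a b, ∃ p q, p < x ∧ x < q ∧ Q p q)
    (hglue : ∀ m ∈ Icc a b, ∀ p q p' q', p < m → m < q → p' < m → m < q' → Q p q → Q p' q' →
      Q p q') : ∃ p q, p < a ∧ b < q ∧ Q p q := by
  obtain ⟨p₀, q₀, hp₀, hq₀, hQ₀⟩ := hloc a (left_mem_Icc.2 hab)
  let T : Set ℝ := {x | x ∈ Icc a b ∧ ∃ q, x < q ∧ Q p₀ q}
  have haT : a ∈ T := ⟨left_mem_Icc.2 hab, q₀, hq₀, hQ₀⟩
  have hTb : BddAbove T := ⟨b, fun x hx => hx.1.2⟩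
  have hac : a ≤ sSup T := le_csSup hTb haT
  have hcb : sSup T ≤ b := csSup_le ⟨a, haT⟩ fun x hx => hx.1.2
  -- An interval around the supremum of the points reached from `a` overlaps one already reached;
  -- gluing them gives `Q p₀ q`, and `q ≤ b` would produce a reached point beyond the supremum.
  obtain ⟨p, q, hp, hq, hQ⟩ := hloc (sSup T) ⟨hac, hcb⟩
  obtain ⟨x, hx, hpx⟩ := exists_lt_of_lt_csSup ⟨a, haT⟩ hp
  obtain ⟨q₁, hxq₁, hQ₁⟩ := hx.2
  have hxc : x ≤ sSup T := le_csSup hTb hx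
  have hQ' : Q p₀ q := hglue x hx.1 p₀ q₁ p q (hp₀.trans_le hx.1.1) hxq₁ hpx (hxc.trans_lt hq) hQ₁ hQ
  refine ⟨p₀, q, hp₀, ?_, hQ'⟩
  by_contra hbq
  rw [not_lt] at hbq
  obtain ⟨c', hc', hc'q⟩ := exists_between hq
  exact (le_csSup hTb ⟨⟨hac.trans hc'.le, hc'q.le.trans hbq⟩, q, hc'q, hQ'⟩).not_gt hc'

/-! ### Gluing local lifts over a rectangle -/

namespace PathConn

section GlobalExistence

variable {EG : Type*} [NormedAddCommGroup EG] [NormedSpace ℝ EG]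
  {G : Type*} [TopologicalSpace G] [ChartedSpace EG G] [Group G]
  {M : Type*}
  {EP : Type*} [NormedAddCommGroup EP] [NormedSpace ℝ EP]
  {P : Type*} [TopologicalSpace P] [ChartedSpace EP P]
  {E' : Type*} [NormedAddCommGroup E'] [NormedSpace ℝ E']
  {A : ∀ p : P, TangentSpace 𝓘(ℝ, EP) p →L[ℝ] GroupLieAlgebra 𝓘(ℝ, EG) G} {π : P → M}

/-- `Γ : S → M` has a horizontal lift over `S ∩ W`. -/
def HasLiftOn (A : ∀ p : P, TangentSpace 𝓘(ℝ, EP) p →L[ℝ] GroupLieAlgebra 𝓘(ℝ, EG) G)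
    (π : P → M) (S : Set E') (Γ : E' → M) (W : Set E') : Prop :=
  ∃ F : E' → P, ∀ x ∈ S ∩ W, IsHorizontalAt A S F x ∧ π (F x) = Γ x

theorem HasLiftOn.mono {S : Set E'} {Γ : E' → M} {W W' : Set E'} (h : HasLiftOn A π S Γ W)
    (hW : S ∩ W' ⊆ W) : HasLiftOn A π S Γ W' := by
  obtain ⟨F, hF⟩ := h
  exact ⟨F, fun x hx => hF x ⟨hx.1, hW hx⟩⟩

variable {EM : Type*} [NormedAddCommGroup EM] [NormedSpace ℝ EM]
  [TopologicalSpace M] [ChartedSpace EM M] [MulAction Gᵐᵒᵖ P]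

theorem IsPrincipalBundle.exists_eq_act (hπ : IsPrincipalBundle EG EM EP G π) {p q : P}
    (h : π p = π q) : ∃ c : G, q = p <• c := by
  obtain ⟨U, -, hxU, σ, k, -, -, hσk, -⟩ := hπ.exists_section (π p)
  have hp := hσk p hxU
  have hq := hσk q (by rw [mem_preimage, ← h]; exact hxU)
  refine ⟨(k p)⁻¹ * k q, ?_⟩
  calc q = σ (π p) <• k q := by rw [h, hq]
    _ = (σ (π p) <• k p) <• ((k p)⁻¹ * k q) := by
      simp only [smul_smul, ← MulOpposite.op_mul, mul_inv_cancel_left]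
    _ = _ := by rw [hp]

variable [IsManifold 𝓘(ℝ, EP) ∞ P] [LieGroup 𝓘(ℝ, EG) ∞ G]

/-- After right translation by a constant the two lifts agree at `x₁`, hence on the whole convex
overlap. The glued lift switches from one to the other across the level set `l = m`, whose points in
`W` lie in both domains, so it is locally equal to one of them. -/
theorem HasLiftOn.glue (hA : IsConnectionForm A) (hπ : IsPrincipalBundle EG EM EP G π)
    {S : Set E'} (hS : Convex ℝ S) (hSu : UniqueDiffOn ℝ S) {Γ : E' → M} {W₁ W₂ W : Set E'}
    (hW₁ : IsOpen W₁) (hW₁c : Convex ℝ W₁) (hW₂ : IsOpen W₂) (hW₂c : Convex ℝ W₂) {x₁ : E'}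
    (hx₁ : x₁ ∈ S ∩ (W₁ ∩ W₂)) {l : E' → ℝ} (hl : Continuous l) {m : ℝ}
    (hle : ∀ x ∈ W, l x ≤ m → x ∈ W₁) (hge : ∀ x ∈ W, m ≤ l x → x ∈ W₂)
    (h₁ : HasLiftOn A π S Γ W₁) (h₂ : HasLiftOn A π S Γ W₂) : HasLiftOn A π S Γ W := by
  obtain ⟨F₁, hF₁⟩ := h₁
  obtain ⟨F₂, hF₂⟩ := h₂
  obtain ⟨c, hc⟩ := hπ.exists_eq_act (p := F₂ x₁) (q := F₁ x₁)
    ((hF₂ x₁ ⟨hx₁.1, hx₁.2.2⟩).2.trans (hF₁ x₁ ⟨hx₁.1, hx₁.2.1⟩).2.symm)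
  have hF₂' : ∀ x ∈ S ∩ W₂, IsHorizontalAt A S (fun y => F₂ y <• c) x ∧ π (F₂ x <• c) = Γ x :=
    fun x hx => ⟨(hF₂ x hx).1.act hA hπ hSu hx.1 c, (hπ.proj_act _ _).trans (hF₂ x hx).2⟩
  have heq : EqOn F₁ (fun y => F₂ y <• c) (S ∩ (W₁ ∩ W₂)) :=
    IsHorizontalAt.eqOn hA hπ hS hSu (hW₁.inter hW₂) (hW₁c.inter hW₂c)
      (fun y hy => (hF₁ y ⟨hy.1, hy.2.1⟩).1) (fun y hy => (hF₂' y ⟨hy.1, hy.2.2⟩).1)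
      (fun y hy => (hF₁ y ⟨hy.1, hy.2.1⟩).2.trans (hF₂' y ⟨hy.1, hy.2.2⟩).2.symm) hx₁ hc
  classical
  refine ⟨fun y => if l y ≤ m then F₁ y else F₂ y <• c, fun x hx => ?_⟩
  rcases lt_trichotomy (l x) m with hlt | hxm | hgt
  · have hx' : x ∈ S ∩ W₁ := ⟨hx.1, hle x hx.2 hlt.le⟩
    refine ⟨(hF₁ x hx').1.congr hx.1 ?_, (congrArg π (if_pos hlt.le)).trans (hF₁ x hx').2⟩
    filter_upwards [mem_nhdsWithin_of_mem_nhds ((isOpen_lt hl continuous_const).mem_nhds hlt)]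
      with y hy using if_pos (le_of_lt hy)
  · have hx' : x ∈ S ∩ (W₁ ∩ W₂) := ⟨hx.1, hle x hx.2 hxm.le, hge x hx.2 hxm.ge⟩
    refine ⟨(hF₁ x ⟨hx.1, hx'.2.1⟩).1.congr hx.1 ?_,
      (congrArg π (if_pos hxm.le)).trans (hF₁ x ⟨hx.1, hx'.2.1⟩).2⟩
    filter_upwards [self_mem_nhdsWithin,
      mem_nhdsWithin_of_mem_nhds ((hW₁.inter hW₂).mem_nhds hx'.2)] with y hyS hyW
    split_ifs
    · rfl
    · exact (heq ⟨hyS, hyW⟩).symm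
  · have hx' : x ∈ S ∩ W₂ := ⟨hx.1, hge x hx.2 hgt.le⟩
    refine ⟨(hF₂' x hx').1.congr hx.1 ?_, (congrArg π (if_neg hgt.not_ge)).trans (hF₂' x hx').2⟩
    filter_upwards [mem_nhdsWithin_of_mem_nhds ((isOpen_lt continuous_const hl).mem_nhds hgt)]
      with y hy using if_neg (not_le_of_gt hy)

/-- Horizontal lifts over a rectangle exist if they exist locally. -/
theorem hasLiftOn_rectangle (hA : IsConnectionForm A) (hπ : IsPrincipalBundle EG EM EP G π)
    {s₀ s₁ t₀ t₁ : ℝ} (hs : s₀ < s₁) (ht : t₀ < t₁) {Γ : ℝ × ℝ → M}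
    (hloc : ∀ x₀ ∈ Icc s₀ s₁ ×ˢ Icc t₀ t₁, ∃ ρ > 0,
      HasLiftOn A π (Icc s₀ s₁ ×ˢ Icc t₀ t₁) Γ (ball x₀ ρ)) :
    HasLiftOn A π (Icc s₀ s₁ ×ˢ Icc t₀ t₁) Γ univ := by
  have hS : Convex ℝ (Icc s₀ s₁ ×ˢ Icc t₀ t₁) := (convex_Icc s₀ s₁).prod (convex_Icc t₀ t₁)
  have hSu : UniqueDiffOn ℝ (Icc s₀ s₁ ×ˢ Icc t₀ t₁) :=
    (uniqueDiffOn_Icc hs).prod (uniqueDiffOn_Icc ht)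
  -- Gluing runs in two stages: small boxes in the `v` direction into a strip around each `u`, the
  -- width shrinking to the smaller one at each gluing, and then the strips in the `u` direction.
  have hstrip : ∀ u ∈ Icc s₀ s₁, ∃ p q, p < u ∧ u < q ∧
      HasLiftOn A π (Icc s₀ s₁ ×ˢ Icc t₀ t₁) Γ (Ioo p q ×ˢ univ) := by
    intro u hu
    obtain ⟨p, q, hp, hq, ε, hε, h⟩ := exists_of_local_of_glue ht.le
      (Q := fun p q => ∃ ε > 0,
        HasLiftOn A π (Icc s₀ s₁ ×ˢ Icc t₀ t₁) Γ (Ioo (u - ε) (u + ε) ×ˢ Ioo p q))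
      (fun v hv => by
        obtain ⟨ρ, hρ, h⟩ := hloc (u, v) ⟨hu, hv⟩
        refine ⟨v - ρ, v + ρ, by linarith, by linarith, ρ, hρ, ?_⟩
        rwa [← Real.ball_eq_Ioo, ← Real.ball_eq_Ioo, ball_prod_same])
      (by
        rintro m hm p q p' q' hp hq hp' hq' ⟨ε, hε, h⟩ ⟨ε', hε', h'⟩
        refine ⟨min ε ε', lt_min hε hε', HasLiftOn.glue hA hπ hS hSu
          (isOpen_Ioo.prod isOpen_Ioo) ((convex_Ioo _ _).prod (convex_Ioo _ _))
          (isOpen_Ioo.prod isOpen_Ioo) ((convex_Ioo _ _).prod (convex_Ioo _ _))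
          (x₁ := (u, m)) ⟨⟨hu, hm⟩, ⟨⟨by linarith, by linarith⟩, hp, hq⟩,
            ⟨⟨by linarith, by linarith⟩, hp', hq'⟩⟩ continuous_snd (m := m)
          (fun x hx hxm => ?_) (fun x hx hxm => ?_) h h'⟩
        · have := min_le_left ε ε'
          exact ⟨⟨by linarith [hx.1.1], by linarith [hx.1.2]⟩, hx.2.1, hxm.trans_lt hq⟩
        · have := min_le_right ε ε'
          exact ⟨⟨by linarith [hx.1.1], by linarith [hx.1.2]⟩, hp'.trans_le hxm, hx.2.2⟩)
    refine ⟨u - ε, u + ε, by linarith, by linarith, h.mono fun x hx => ⟨hx.2.1, ?_, ?_⟩⟩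
    · exact hp.trans_le hx.1.2.1
    · exact hx.1.2.2.trans_lt hq
  obtain ⟨p, q, hp, hq, h⟩ := exists_of_local_of_glue hs.le hstrip (by
    intro m hm p q p' q' hp hq hp' hq' h h'
    refine HasLiftOn.glue hA hπ hS hSu
      (isOpen_Ioo.prod isOpen_univ) ((convex_Ioo _ _).prod convex_univ)
      (isOpen_Ioo.prod isOpen_univ) ((convex_Ioo _ _).prod convex_univ)
      (x₁ := (m, t₀)) ⟨⟨hm, left_mem_Icc.2 ht.le⟩, ⟨⟨hp, hq⟩, mem_univ _⟩,
        ⟨⟨hp', hq'⟩, mem_univ _⟩⟩ continuous_fst (m := m)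
      (fun x hx hxm => ?_) (fun x hx hxm => ?_) h h'
    · exact ⟨⟨hx.1.1, hxm.trans_lt hq⟩, mem_univ _⟩
    · exact ⟨⟨hp'.trans_le hxm, hx.1.2⟩, mem_univ _⟩)
  exact h.mono fun x hx => ⟨⟨hp.trans_le hx.1.1.1, hx.1.1.2.trans_lt hq⟩, mem_univ _⟩

end GlobalExistence

/-! ### Thin maps and the kernel of the derivative -/

section Partials

variable {E : Type*} [NormedAddCommGroup E] [NormedSpace ℝ E]
  {X : Type*} [TopologicalSpace X] [ChartedSpace E X] {s₀ s₁ t₀ t₁ : ℝ} {f : ℝ × ℝ → X} {u v : ℝ}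

theorem velocity_left (hs : s₀ < s₁) (hu : u ∈ Icc s₀ s₁) (hv : v ∈ Icc t₀ t₁)
    (hf : MDifferentiableWithinAt 𝓘(ℝ, ℝ × ℝ) 𝓘(ℝ, E) f (Icc s₀ s₁ ×ˢ Icc t₀ t₁) (u, v)) :
    velocity E s₀ s₁ (fun s => f (s, v)) u =
      mfderivWithin 𝓘(ℝ, ℝ × ℝ) 𝓘(ℝ, E) f (Icc s₀ s₁ ×ˢ Icc t₀ t₁) (u, v) ((1, 0) : ℝ × ℝ) := by
  have h1 : HasMFDerivWithinAt 𝓘(ℝ, ℝ) 𝓘(ℝ, ℝ × ℝ) (fun s : ℝ => (s, v)) (Icc s₀ s₁) u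
      ((ContinuousLinearMap.id ℝ ℝ).prod 0) :=
    ((hasFDerivWithinAt_id u _).prodMk (hasFDerivWithinAt_const v u _)).hasMFDerivWithinAt
  have h2 := HasMFDerivWithinAt.comp u (f := fun s : ℝ => (s, v)) (u := Icc s₀ s₁ ×ˢ Icc t₀ t₁)
    hf.hasMFDerivWithinAt h1 (fun s hs => ⟨hs, hv⟩)
  have h3 := h2.mfderivWithin ((uniqueDiffOn_Icc hs).uniqueMDiffOn u hu)
  exact congrArg (fun L : ℝ →L[ℝ] E => L 1) h3

theorem velocity_right (ht : t₀ < t₁) (hu : u ∈ Icc s₀ s₁) (hv : v ∈ Icc t₀ t₁)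
    (hf : MDifferentiableWithinAt 𝓘(ℝ, ℝ × ℝ) 𝓘(ℝ, E) f (Icc s₀ s₁ ×ˢ Icc t₀ t₁) (u, v)) :
    velocity E t₀ t₁ (fun t => f (u, t)) v =
      mfderivWithin 𝓘(ℝ, ℝ × ℝ) 𝓘(ℝ, E) f (Icc s₀ s₁ ×ˢ Icc t₀ t₁) (u, v) ((0, 1) : ℝ × ℝ) := by
  have h1 : HasMFDerivWithinAt 𝓘(ℝ, ℝ) 𝓘(ℝ, ℝ × ℝ) (fun t : ℝ => (u, t)) (Icc t₀ t₁) v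
      (ContinuousLinearMap.prod 0 (ContinuousLinearMap.id ℝ ℝ)) :=
    ((hasFDerivWithinAt_const u v _).prodMk (hasFDerivWithinAt_id v _)).hasMFDerivWithinAt
  have h2 := HasMFDerivWithinAt.comp v (f := fun t : ℝ => (u, t)) (u := Icc s₀ s₁ ×ˢ Icc t₀ t₁)
    hf.hasMFDerivWithinAt h1 (fun t ht => ⟨hu, ht⟩)
  have h3 := h2.mfderivWithin ((uniqueDiffOn_Icc ht).uniqueMDiffOn v hv)
  exact congrArg (fun L : ℝ →L[ℝ] E => L 1) h3

/-- A thin map has a nonzero direction in which its derivative vanishes. -/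
theorem IsThin.exists_ker (hf : IsThin E s₀ s₁ t₀ t₁ f) (hs : s₀ < s₁) (ht : t₀ < t₁)
    (hu : u ∈ Icc s₀ s₁) (hv : v ∈ Icc t₀ t₁)
    (hfd : MDifferentiableWithinAt 𝓘(ℝ, ℝ × ℝ) 𝓘(ℝ, E) f (Icc s₀ s₁ ×ˢ Icc t₀ t₁) (u, v)) :
    ∃ c d : ℝ, (c ≠ 0 ∨ d ≠ 0) ∧ mfderivWithin 𝓘(ℝ, ℝ × ℝ) 𝓘(ℝ, E) f (Icc s₀ s₁ ×ˢ Icc t₀ t₁) (u, v)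
      ((c, d) : ℝ × ℝ) = 0 := by
  have h1 := hf u hu v hv
  rw [LinearIndependent.pair_iff] at h1
  push Not at h1
  obtain ⟨c, d, h2, h3⟩ := h1
  refine ⟨c, d, ?_, ?_⟩
  · by_cases hc : c = 0
    · exact Or.inr (h3 hc)
    · exact Or.inl hc
  · rw [velocity_left hs hu hv hfd, velocity_right ht hu hv hfd] at h2
    let L : ℝ × ℝ →L[ℝ] E := mfderivWithin 𝓘(ℝ, ℝ × ℝ) 𝓘(ℝ, E) f (Icc s₀ s₁ ×ˢ Icc t₀ t₁) (u, v)
    have h4 : L (c, d) = c • L (1, 0) + d • L (0, 1) := by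
      rw [← map_smul, ← map_smul, ← map_add]
      simp
    exact h4.trans h2

theorem IsThin.of_ker (hs : s₀ < s₁) (ht : t₀ < t₁)
    (hfd : ∀ u ∈ Icc s₀ s₁, ∀ v ∈ Icc t₀ t₁,
      MDifferentiableWithinAt 𝓘(ℝ, ℝ × ℝ) 𝓘(ℝ, E) f (Icc s₀ s₁ ×ˢ Icc t₀ t₁) (u, v))
    (h : ∀ u ∈ Icc s₀ s₁, ∀ v ∈ Icc t₀ t₁, ∃ c d : ℝ, (c ≠ 0 ∨ d ≠ 0) ∧
      mfderivWithin 𝓘(ℝ, ℝ × ℝ) 𝓘(ℝ, E) f (Icc s₀ s₁ ×ˢ Icc t₀ t₁) (u, v) ((c, d) : ℝ × ℝ) = 0) :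
    IsThin E s₀ s₁ t₀ t₁ f := by
  intro u hu v hv hli
  obtain ⟨c, d, hcd, h0⟩ := h u hu v hv
  rw [LinearIndependent.pair_iff] at hli
  have h1 := hli c d (by
    rw [velocity_left hs hu hv (hfd u hu v hv), velocity_right ht hu hv (hfd u hu v hv)]
    let L : ℝ × ℝ →L[ℝ] E := mfderivWithin 𝓘(ℝ, ℝ × ℝ) 𝓘(ℝ, E) f (Icc s₀ s₁ ×ˢ Icc t₀ t₁) (u, v)
    have h4 : L (c, d) = c • L (1, 0) + d • L (0, 1) := by
      rw [← map_smul, ← map_smul, ← map_add]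
      simp
    exact h4.symm.trans h0)
  rcases hcd with hc | hd
  exacts [hc h1.1, hd h1.2]

end Partials

end PathConn

/-- A linear map on the plane with nontrivial kernel has rank at most one. -/
theorem LinearMap.exists_smul_add_smul_eq_zero_of_prod {V : Type*} [AddCommGroup V] [Module ℝ V]
    (L : ℝ × ℝ →ₗ[ℝ] V) {c d : ℝ} (hcd : c ≠ 0 ∨ d ≠ 0) (hL : L (c, d) = 0) (ξ ξ' : ℝ × ℝ) :
    ∃ a b : ℝ, (a ≠ 0 ∨ b ≠ 0) ∧ L (a • ξ + b • ξ') = 0 := by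
  -- A vanishing determinant with `(c, d)` means that `w` is a multiple of `(c, d)`.
  have key : ∀ w : ℝ × ℝ, w.1 * d - w.2 * c = 0 → L w = 0 := by
    rintro ⟨w₁, w₂⟩ hw
    simp only at hw
    rcases hcd with hc | hd
    · have h1 : ((w₁, w₂) : ℝ × ℝ) = (w₁ / c) • (c, d) := by
        ext
        · simp; field_simp
        · simp; field_simp; linarith
      rw [h1, map_smul, hL, smul_zero]
    · have h1 : ((w₁, w₂) : ℝ × ℝ) = (w₂ / d) • (c, d) := by
        ext
        · simp; field_simp; linarith
        · simp; field_simp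
      rw [h1, map_smul, hL, smul_zero]
  by_cases h : ξ'.1 * d - ξ'.2 * c = 0
  · exact ⟨0, 1, Or.inr one_ne_zero, key _ (by simpa using h)⟩
  · refine ⟨ξ'.1 * d - ξ'.2 * c, -(ξ.1 * d - ξ.2 * c), Or.inl h, key _ ?_⟩
    simp only [Prod.fst_add, Prod.snd_add, Prod.smul_fst, Prod.smul_snd, smul_eq_mul]
    ring

/-- Inserting `w = x` and `w = y` gives `d • f y x = 0` and `c • f x y = 0`; antisymmetry makes
either one enough. -/
theorem apply_eq_zero_of_alternating {V W : Type*} [AddCommGroup V] [Module ℝ V] [AddCommGroup W]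
    [Module ℝ W] (f : V →ₗ[ℝ] V →ₗ[ℝ] W) (hf : ∀ v, f v v = 0) {x y : V} {c d : ℝ}
    (hcd : c ≠ 0 ∨ d ≠ 0) (h : ∀ w, f (c • x + d • y) w = 0) : f y x = 0 := by
  have h1 := h x
  have h2 := h y
  have h3 := hf (x + y)
  simp only [map_add, map_smul, LinearMap.add_apply, LinearMap.smul_apply, hf, smul_zero, zero_add,
    add_zero] at h1 h2 h3
  rcases hcd with hc | hd
  · have h4 : f x y = 0 := (smul_eq_zero.1 h2).resolve_left hc
    rwa [h4, add_zero] at h3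
  · exact (smul_eq_zero.1 h1).resolve_left hd

/-! ### Lifts of thin maps and vanishing of the 2-form -/

namespace PathConn

section Lifts

variable {EG : Type*} [NormedAddCommGroup EG] [NormedSpace ℝ EG]
  {G : Type*} [TopologicalSpace G] [ChartedSpace EG G] [Group G]
  {EP : Type*} [NormedAddCommGroup EP] [NormedSpace ℝ EP]
  {P : Type*} [TopologicalSpace P] [ChartedSpace EP P]
  {A : ∀ p : P, TangentSpace 𝓘(ℝ, EP) p →L[ℝ] GroupLieAlgebra 𝓘(ℝ, EG) G}

/-- On an interval the derivative is determined by its value on `1`, the velocity. -/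
theorem isHorizontalPath_iff {t₀ t₁ : ℝ} {γ : ℝ → P} :
    IsHorizontalPath A t₀ t₁ γ ↔ ∀ t ∈ Icc t₀ t₁, IsHorizontalAt A (Icc t₀ t₁) γ t := by
  refine ⟨fun h t ht => ⟨h.1 t ht, fun ξ => ?_⟩, fun h => ⟨fun t ht => (h t ht).smooth,
    fun t ht => (h t ht).horizontal 1⟩⟩
  let L : ℝ →L[ℝ] EP := mfderivWithin 𝓘(ℝ, ℝ) 𝓘(ℝ, EP) γ (Icc t₀ t₁) t
  have h1 : L ξ = ξ • L 1 := by rw [← map_smul]; simp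
  refine (congrArg (A (γ t)) h1).trans ?_
  refine ((A (γ t)).map_smul ξ (L 1)).trans ?_
  rw [show A (γ t) (L 1) = 0 from h.2 t ht, smul_zero]

theorem isHorizontalAt_const {E' : Type*} [NormedAddCommGroup E'] [NormedSpace ℝ E'] {S : Set E'}
    (p : P) (x : E') : IsHorizontalAt A S (fun _ => p) x := by
  refine ⟨contMDiffWithinAt_const, fun ξ => ?_⟩
  rw [mfderivWithin_const]
  exact map_zero (A p)

/-- Restriction of horizontality along a smooth map of the parameter spaces. -/
theorem IsHorizontalAt.comp_right {E₁ E₂ : Type*} [NormedAddCommGroup E₁] [NormedSpace ℝ E₁]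
    [NormedAddCommGroup E₂] [NormedSpace ℝ E₂] {S : Set E₁} {T : Set E₂} (hT : UniqueDiffOn ℝ T)
    {F : E₁ → P} {f : E₂ → E₁} (hf : ContDiff ℝ ∞ f) (hfT : MapsTo f T S) {x : E₂} (hx : x ∈ T)
    (h : IsHorizontalAt A S F (f x)) : IsHorizontalAt A T (fun y => F (f y)) x := by
  refine IsHorizontalAt.of_hasMFDerivWithinAt hT hx
    (h.smooth.comp x (f := f) (hf.contMDiff x).contMDiffWithinAt hfT)
    (h.hasMFDerivWithinAt.comp x (f := f) (s := T)
      ((hf.differentiable (by simp) x).hasFDerivAt.hasFDerivWithinAt.hasMFDerivWithinAt) hfT)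
    fun ξ => h.horizontal _

variable {EM : Type*} [NormedAddCommGroup EM] [NormedSpace ℝ EM]
  {M : Type*} [TopologicalSpace M] [ChartedSpace EM M] {π : P → M}

theorem mfderiv_proj_mfderivWithin {E' : Type*} [NormedAddCommGroup E'] [NormedSpace ℝ E']
    (hπ : ContMDiff 𝓘(ℝ, EP) 𝓘(ℝ, EM) ∞ π) {S : Set E'} (hS : UniqueDiffOn ℝ S)
    {F : E' → P} {Γ : E' → M} (hF : ∀ x ∈ S, π (F x) = Γ x) {x : E'} (hx : x ∈ S)
    (hFd : MDifferentiableWithinAt 𝓘(ℝ, E') 𝓘(ℝ, EP) F S x) (w : E') :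
    mfderiv 𝓘(ℝ, EP) 𝓘(ℝ, EM) π (F x) (mfderivWithin 𝓘(ℝ, E') 𝓘(ℝ, EP) F S x w) =
      (mfderivWithin 𝓘(ℝ, E') 𝓘(ℝ, EM) Γ S x w : EM) := by
  have h1 := HasMFDerivAt.comp_hasMFDerivWithinAt x
    (hπ.mdifferentiable (by simp) (F x)).hasMFDerivAt hFd.hasMFDerivWithinAt
  have h2 := h1.congr_of_eventuallyEq (f₁ := Γ)
    (by filter_upwards [self_mem_nhdsWithin] with y hy using (hF y hy).symm) (hF x hx).symm
  rw [h2.mfderivWithin (hS.uniqueMDiffOn x hx)]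
  rfl

variable [MulAction Gᵐᵒᵖ P] [IsManifold 𝓘(ℝ, EP) ∞ P] [LieGroup 𝓘(ℝ, EG) ∞ G]

theorem IsHorizontalLift.eqOn (hA : IsConnectionForm A) (hπ : IsPrincipalBundle EG EM EP G π)
    {t₀ t₁ : ℝ} (ht : t₀ < t₁) {c : ℝ → M} {γ₁ γ₂ : ℝ → P} (h₁ : IsHorizontalLift π A t₀ t₁ c γ₁)
    (h₂ : IsHorizontalLift π A t₀ t₁ c γ₂) (h : γ₁ t₀ = γ₂ t₀) : EqOn γ₁ γ₂ (Icc t₀ t₁) := by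
  have h₃ := IsHorizontalAt.eqOn hA hπ (convex_Icc t₀ t₁) (uniqueDiffOn_Icc ht) isOpen_univ
    convex_univ (fun y hy => isHorizontalPath_iff.1 h₁.1 y hy.1)
    (fun y hy => isHorizontalPath_iff.1 h₂.1 y hy.1)
    (fun y hy => (h₁.2 y hy.1).trans (h₂.2 y hy.1).symm)
    ⟨left_mem_Icc.2 ht.le, mem_univ _⟩ h
  rwa [inter_univ] at h₃

/-- A horizontal path over a constant path is constant. -/
theorem IsHorizontalPath.eq_of_proj_const (hA : IsConnectionForm A)
    (hπ : IsPrincipalBundle EG EM EP G π) {t₀ t₁ : ℝ} (ht : t₀ < t₁) {γ : ℝ → P}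
    (h : IsHorizontalPath A t₀ t₁ γ) (hc : ∀ t ∈ Icc t₀ t₁, π (γ t) = π (γ t₀)) {t : ℝ}
    (htt : t ∈ Icc t₀ t₁) : γ t = γ t₀ :=
  IsHorizontalLift.eqOn hA hπ ht (c := fun _ => π (γ t₀)) (γ₂ := fun _ => γ t₀) ⟨h, hc⟩
    ⟨isHorizontalPath_iff.2 fun t _ => isHorizontalAt_const _ t, fun _ _ => rfl⟩ rfl htt

/-- A thin map of a rectangle has a horizontal lift, unique up to its value at a corner. -/
theorem IsThin.exists_lift [FiniteDimensional ℝ EG] [FiniteDimensional ℝ EP]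
    (hA : IsConnectionForm A) (hπ : IsPrincipalBundle EG EM EP G π)
    {s₀ s₁ t₀ t₁ : ℝ} (hs : s₀ < s₁) (ht : t₀ < t₁) {Γ : ℝ × ℝ → M}
    (hΓ : ContMDiffOn 𝓘(ℝ, ℝ × ℝ) 𝓘(ℝ, EM) ∞ Γ (Icc s₀ s₁ ×ˢ Icc t₀ t₁))
    (hthin : IsThin EM s₀ s₁ t₀ t₁ Γ) {p : P} (hp : π p = Γ (s₀, t₀)) :
    ∃ F : ℝ × ℝ → P, F (s₀, t₀) = p ∧ ∀ x ∈ Icc s₀ s₁ ×ˢ Icc t₀ t₁,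
      IsHorizontalAt A (Icc s₀ s₁ ×ˢ Icc t₀ t₁) F x ∧ π (F x) = Γ x := by
  have hS : Convex ℝ (Icc s₀ s₁ ×ˢ Icc t₀ t₁) := (convex_Icc s₀ s₁).prod (convex_Icc t₀ t₁)
  have hSi : (interior (Icc s₀ s₁ ×ˢ Icc t₀ t₁)).Nonempty := by
    rw [interior_prod_eq, interior_Icc, interior_Icc]
    exact (nonempty_Ioo.2 hs).prod (nonempty_Ioo.2 ht)
  obtain ⟨F, hF⟩ := hasLiftOn_rectangle (Γ := Γ) hA hπ hs ht fun x₀ hx₀ => by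
    obtain ⟨F, ρ, hρ, h⟩ := hA.exists_local_lift hπ hS hSi hΓ (fun x hx ξ ξ' => by
      obtain ⟨c, d, hcd, h0⟩ := hthin.exists_ker hs ht hx.1 hx.2
        ((hΓ x hx).mdifferentiableWithinAt (by simp))
      let L : ℝ × ℝ →L[ℝ] EM :=
        mfderivWithin 𝓘(ℝ, ℝ × ℝ) 𝓘(ℝ, EM) Γ (Icc s₀ s₁ ×ˢ Icc t₀ t₁) x
      exact (L : ℝ × ℝ →ₗ[ℝ] EM).exists_smul_add_smul_eq_zero_of_prod hcd h0 ξ ξ') hx₀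
    exact ⟨ρ, hρ, F, h⟩
  have hx₀ : ((s₀, t₀) : ℝ × ℝ) ∈ Icc s₀ s₁ ×ˢ Icc t₀ t₁ :=
    ⟨left_mem_Icc.2 hs.le, left_mem_Icc.2 ht.le⟩
  obtain ⟨c, hc⟩ := hπ.exists_eq_act ((hF _ ⟨hx₀, mem_univ _⟩).2.trans hp.symm)
  refine ⟨fun x => F x <• c, hc.symm, fun x hx => ?_⟩
  obtain ⟨h1, h2⟩ := hF x ⟨hx, mem_univ _⟩
  exact ⟨h1.act hA hπ ((uniqueDiffOn_Icc hs).prod (uniqueDiffOn_Icc ht)) hx c,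
    (hπ.proj_act _ _).trans h2⟩

end Lifts

section Velocity

variable {EP : Type*} [NormedAddCommGroup EP] [NormedSpace ℝ EP]
  {P : Type*} [TopologicalSpace P] [ChartedSpace EP P] [IsManifold 𝓘(ℝ, EP) ∞ P]
  {EM : Type*} [NormedAddCommGroup EM] [NormedSpace ℝ EM]
  {M : Type*} [TopologicalSpace M] [ChartedSpace EM M] {π : P → M}
  {G : Type*} [Group G] [MulAction Gᵐᵒᵖ P]
  {EH : Type*} [NormedAddCommGroup EH] [NormedSpace ℝ EH]
  {H : Type*} [TopologicalSpace H] [ChartedSpace EH H] [Group H]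

/-- An equivariant 2-form that vanishes on vertical vectors vanishes on the partial derivatives of
any lift of a thin map. -/
theorem IsEquivariantTwoForm.apply_velocity_eq_zero {α : G →* MulAut H}
    {B : ∀ p : P, TangentSpace 𝓘(ℝ, EP) p →L[ℝ] TangentSpace 𝓘(ℝ, EP) p →L[ℝ]
      GroupLieAlgebra 𝓘(ℝ, EH) H} (hB : IsEquivariantTwoForm EM π α B)
    (hπ : ContMDiff 𝓘(ℝ, EP) 𝓘(ℝ, EM) ∞ π)
    {s₀ s₁ t₀ t₁ : ℝ} (hs : s₀ < s₁) (ht : t₀ < t₁) {Γ : ℝ × ℝ → M}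
    (hΓ : ContMDiffOn 𝓘(ℝ, ℝ × ℝ) 𝓘(ℝ, EM) ∞ Γ (Icc s₀ s₁ ×ˢ Icc t₀ t₁))
    (hthin : IsThin EM s₀ s₁ t₀ t₁ Γ) {F : ℝ × ℝ → P}
    (hF : ContMDiffOn 𝓘(ℝ, ℝ × ℝ) 𝓘(ℝ, EP) ∞ F (Icc s₀ s₁ ×ˢ Icc t₀ t₁))
    (hFΓ : ∀ x ∈ Icc s₀ s₁ ×ˢ Icc t₀ t₁, π (F x) = Γ x) {u v : ℝ} (hu : u ∈ Icc s₀ s₁)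
    (hv : v ∈ Icc t₀ t₁) :
    B (F (u, v)) (velocity EP t₀ t₁ (fun t => F (u, t)) v)
      (velocity EP s₀ s₁ (fun s => F (s, v)) u) = 0 := by
  have hFd : MDifferentiableWithinAt 𝓘(ℝ, ℝ × ℝ) 𝓘(ℝ, EP) F (Icc s₀ s₁ ×ˢ Icc t₀ t₁) (u, v) :=
    (hF (u, v) ⟨hu, hv⟩).mdifferentiableWithinAt (by simp)
  obtain ⟨c, d, hcd, h0⟩ := hthin.exists_ker hs ht hu hv
    ((hΓ (u, v) ⟨hu, hv⟩).mdifferentiableWithinAt (by simp))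
  let b : EP →L[ℝ] EP →L[ℝ] EH := B (F (u, v))
  let f : EP →ₗ[ℝ] EP →ₗ[ℝ] EH := (ContinuousLinearMap.coeLM ℝ).comp (b : EP →ₗ[ℝ] EP →L[ℝ] EH)
  -- The direction `(c, d)` killed by the derivative of `Γ` is sent by that of `F` to a vertical
  -- vector, which lies in the kernel of `B`.
  refine apply_eq_zero_of_alternating f (fun v => hB.alternating _ v) hcd fun w => ?_
  refine hB.vertical (F (u, v)) _ w ?_
  rw [velocity_left hs hu hv hFd, velocity_right ht hu hv hFd]
  have h1 := mfderiv_proj_mfderivWithin hπ ((uniqueDiffOn_Icc hs).prod (uniqueDiffOn_Icc ht)) hFΓ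
    ⟨hu, hv⟩ hFd (c, d)
  let L : ℝ × ℝ →L[ℝ] EP := mfderivWithin 𝓘(ℝ, ℝ × ℝ) 𝓘(ℝ, EP) F (Icc s₀ s₁ ×ˢ Icc t₀ t₁) (u, v)
  have h4 : L (c, d) = c • L (1, 0) + d • L (0, 1) := by
    rw [← map_smul, ← map_smul, ← map_add]
    simp
  exact (congrArg (mfderiv 𝓘(ℝ, EP) 𝓘(ℝ, EM) π (F (u, v))) h4).symm.trans (h1.trans h0)

end Velocity

end PathConn

end HorizontalLifts

/-! ### The main theorem -/

theorem theoremT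
    {EG EH EM EP : Type*}
    [NormedAddCommGroup EG] [NormedSpace ℝ EG] [FiniteDimensional ℝ EG]
    [NormedAddCommGroup EH] [NormedSpace ℝ EH] [FiniteDimensional ℝ EH]
    [NormedAddCommGroup EM] [NormedSpace ℝ EM] [FiniteDimensional ℝ EM]
    [NormedAddCommGroup EP] [NormedSpace ℝ EP] [FiniteDimensional ℝ EP]
    {G : Type*} [TopologicalSpace G] [T2Space G] [ChartedSpace EG G] [Group G]
    [LieGroup 𝓘(ℝ, EG) ∞ G]
    {H : Type*} [TopologicalSpace H] [T2Space H] [ChartedSpace EH H] [Group H]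
    [LieGroup 𝓘(ℝ, EH) ∞ H]
    {M : Type*} [TopologicalSpace M] [T2Space M] [ChartedSpace EM M]
    [IsManifold 𝓘(ℝ, EM) ∞ M]
    {P : Type*} [TopologicalSpace P] [T2Space P] [ChartedSpace EP P]
    [IsManifold 𝓘(ℝ, EP) ∞ P] [MulAction Gᵐᵒᵖ P]
    (α : G →* MulAut H) (τ : H →* G) (hατ : IsLieCrossedModule EG EH α τ)
    (π : P → M) (hπ : IsPrincipalBundle EG EM EP G π)
    (A Abar : ∀ p : P, TangentSpace 𝓘(ℝ, EP) p →L[ℝ] GroupLieAlgebra 𝓘(ℝ, EG) G)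
    (hA : IsConnectionForm A) (hAbar : IsConnectionForm Abar)
    (B : ∀ p : P, TangentSpace 𝓘(ℝ, EP) p →L[ℝ] TangentSpace 𝓘(ℝ, EP) p →L[ℝ]
      GroupLieAlgebra 𝓘(ℝ, EH) H)
    (hB : IsEquivariantTwoForm EM π α B)
    (s₀ s₁ t₀ t₁ : ℝ) (hs : s₀ < s₁) (ht : t₀ < t₁)
    (Γ : ℝ × ℝ → M)
    (hΓ : ContMDiffOn 𝓘(ℝ, ℝ × ℝ) 𝓘(ℝ, EM) ∞ Γ (Icc s₀ s₁ ×ˢ Icc t₀ t₁))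
    (hthin : IsThin EM s₀ s₁ t₀ t₁ Γ)
    (hleft : ∀ u ∈ Icc s₀ s₁, Γ (u, t₀) = Γ (s₀, t₀))
    (hright : ∀ u ∈ Icc s₀ s₁, Γ (u, t₁) = Γ (s₀, t₁))
    (γ₀ : ℝ → P) (hγ₀ : IsHorizontalLift π Abar t₀ t₁ (fun v => Γ (s₀, v)) γ₀) :
    ∃ Γt : ℝ × ℝ → P,
      -- each `Γt (u, ·)` is the `Abar`-horizontal lift of `Γ (u, ·)` with initial point `γ₀ t₀`
      (∀ u ∈ Icc s₀ s₁,
        IsHorizontalLift π Abar t₀ t₁ (fun v => Γ (u, v)) (fun v => Γt (u, v)) ∧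
        Γt (u, t₀) = γ₀ t₀ ∧
        ∀ γ : ℝ → P, IsHorizontalLift π Abar t₀ t₁ (fun v => Γ (u, v)) γ → γ t₀ = γ₀ t₀ →
          EqOn γ (fun v => Γt (u, v)) (Icc t₀ t₁)) ∧
      -- `Γt` is the `ω_(A,B)`-horizontal lift of `Γ` with initial path `γ₀`
      IsOmegaHorizontalLift π Abar A B τ s₀ s₁ t₀ t₁ Γ Γt ∧
      EqOn (fun v => Γt (s₀, v)) γ₀ (Icc t₀ t₁) ∧
      (∀ Γt' : ℝ × ℝ → P, IsOmegaHorizontalLift π Abar A B τ s₀ s₁ t₀ t₁ Γ Γt' →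
        EqOn (fun v => Γt' (s₀, v)) γ₀ (Icc t₀ t₁) →
        EqOn Γt' Γt (Icc s₀ s₁ ×ˢ Icc t₀ t₁)) ∧
      -- `Γt` is thin and keeps the end points fixed
      IsThin EP s₀ s₁ t₀ t₁ Γt ∧
      (∀ u ∈ Icc s₀ s₁, Γt (u, t₁) = γ₀ t₁) := by
  have hSu : UniqueDiffOn ℝ (Icc s₀ s₁ ×ˢ Icc t₀ t₁) :=
    (uniqueDiffOn_Icc hs).prod (uniqueDiffOn_Icc ht)
  have hs₀ : s₀ ∈ Icc s₀ s₁ := left_mem_Icc.2 hs.le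
  have ht₀ : t₀ ∈ Icc t₀ t₁ := left_mem_Icc.2 ht.le
  have ht₁ : t₁ ∈ Icc t₀ t₁ := right_mem_Icc.2 ht.le
  obtain ⟨F, hF₀, hF⟩ := hthin.exists_lift hAbar hπ hs ht hΓ (hγ₀.2 t₀ ht₀)
  have hFsmooth : ContMDiffOn 𝓘(ℝ, ℝ × ℝ) 𝓘(ℝ, EP) ∞ F (Icc s₀ s₁ ×ˢ Icc t₀ t₁) :=
    fun x hx => (hF x hx).1.smooth
  have hFd : ∀ u ∈ Icc s₀ s₁, ∀ v ∈ Icc t₀ t₁,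
      MDifferentiableWithinAt 𝓘(ℝ, ℝ × ℝ) 𝓘(ℝ, EP) F (Icc s₀ s₁ ×ˢ Icc t₀ t₁) (u, v) :=
    fun u hu v hv => (hFsmooth _ ⟨hu, hv⟩).mdifferentiableWithinAt (by simp)
  have hlift : ∀ u ∈ Icc s₀ s₁,
      IsHorizontalLift π Abar t₀ t₁ (fun v => Γ (u, v)) (fun v => F (u, v)) := fun u hu =>
    ⟨isHorizontalPath_iff.2 fun v hv => (hF (u, v) ⟨hu, hv⟩).1.comp_right (uniqueDiffOn_Icc ht)
      (f := fun v => (u, v)) (contDiff_const.prodMk contDiff_id) (fun v hv => mk_mem_prod hu hv) hv,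
      fun v hv => (hF (u, v) ⟨hu, hv⟩).2⟩
  -- `F` is horizontal in the `u` direction too, so over a constant edge it is constant. This
  -- identifies `F` with the family of lifts starting at `γ₀ t₀`, and fixes the other end point.
  have hend : ∀ v ∈ Icc t₀ t₁, (∀ u ∈ Icc s₀ s₁, Γ (u, v) = Γ (s₀, v)) →
      ∀ u ∈ Icc s₀ s₁, F (u, v) = F (s₀, v) := by
    intro v hv hΓv u hu
    refine IsHorizontalPath.eq_of_proj_const hAbar hπ hs (γ := fun u => F (u, v))
      (isHorizontalPath_iff.2 fun u hu => (hF (u, v) ⟨hu, hv⟩).1.comp_right (uniqueDiffOn_Icc hs)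
        (f := fun u => (u, v)) (contDiff_id.prodMk contDiff_const) (fun u hu => mk_mem_prod hu hv) hu)
      (fun u hu => ?_) hu
    rw [(hF (u, v) ⟨hu, hv⟩).2, (hF (s₀, v) ⟨hs₀, hv⟩).2, hΓv u hu]
  have hleft' : ∀ u ∈ Icc s₀ s₁, F (u, t₀) = γ₀ t₀ := fun u hu =>
    (hend t₀ ht₀ hleft u hu).trans hF₀
  have hinit : EqOn (fun v => F (s₀, v)) γ₀ (Icc t₀ t₁) :=
    IsHorizontalLift.eqOn hAbar hπ ht (hlift s₀ hs₀) hγ₀ hF₀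
  -- Stated for an arbitrary smooth lift of `Γ`, because it serves both to show that `F` is
  -- `ω`-horizontal and to constrain any competitor.
  have hint : ∀ F' : ℝ × ℝ → P,
      ContMDiffOn 𝓘(ℝ, ℝ × ℝ) 𝓘(ℝ, EP) ∞ F' (Icc s₀ s₁ ×ˢ Icc t₀ t₁) →
      (∀ x ∈ Icc s₀ s₁ ×ˢ Icc t₀ t₁, π (F' x) = Γ x) → ∀ u ∈ Icc s₀ s₁,
      omega A B τ t₀ t₁ (fun v => F' (u, v))
        (fun v => velocity EP s₀ s₁ (fun s => F' (s, v)) u) =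
      A (F' (u, t₀)) (velocity EP s₀ s₁ (fun s => F' (s, t₀)) u) := by
    intro F' hF' hF'Γ u hu
    have h1 : (∫ t in t₀..t₁, (B (F' (u, t)) (velocity EP t₀ t₁ (fun t => F' (u, t)) t)
        (velocity EP s₀ s₁ (fun s => F' (s, t)) u) : EH) : EH) = 0 := by
      rw [← intervalIntegral.integral_zero (a := t₀) (b := t₁)]
      refine intervalIntegral.integral_congr fun t htt => ?_
      rw [uIcc_of_le ht.le] at htt
      exact hB.apply_velocity_eq_zero hπ.smooth_proj hs ht hΓ hthin hF' hF'Γ hu htt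
    unfold omega
    refine (congrArg (fun e : EH => A (F' (u, t₀)) (velocity EP s₀ s₁ (fun s => F' (s, t₀)) u) +
      lieMap τ e) h1).trans ?_
    refine (congrArg (fun e => A (F' (u, t₀)) (velocity EP s₀ s₁ (fun s => F' (s, t₀)) u) + e)
      (map_zero (lieMap τ))).trans (add_zero _)
  refine ⟨F, fun u hu => ⟨hlift u hu, hleft' u hu, fun γ hγ hγ₀' =>
    IsHorizontalLift.eqOn hAbar hπ ht hγ (hlift u hu) (hγ₀'.trans (hleft' u hu).symm)⟩,
    ⟨hFsmooth, hlift, fun u hu => ?_⟩, hinit, fun F' hF' hF'₀ => ?_, ?_, fun u hu =>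
    (hend t₁ ht₁ hright u hu).trans (hinit ht₁)⟩
  · rw [hint F hFsmooth (fun x hx => (hF x hx).2) u hu]
    have h1 : HasMFDerivWithinAt 𝓘(ℝ, ℝ) 𝓘(ℝ, EP) (fun s => F (s, t₀)) (Icc s₀ s₁) u 0 :=
      (hasMFDerivWithinAt_const (γ₀ t₀) _ u).congr_of_eventuallyEq
        (by filter_upwards [self_mem_nhdsWithin] with s hs using hleft' s hs) (hleft' u hu)
    have h2 := h1.mfderivWithin ((uniqueDiffOn_Icc hs).uniqueMDiffOn u hu)
    unfold velocity
    rw [h2]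
    exact map_zero (A (F (u, t₀)))
  · have hF'Γ : ∀ x ∈ Icc s₀ s₁ ×ˢ Icc t₀ t₁, π (F' x) = Γ x := fun x hx =>
      (hF'.lift x.1 hx.1).2 x.2 hx.2
    -- With the integral gone, `ω`-horizontality says that the initial points of a competitor form a
    -- path horizontal for `A`, not `Abar`. It lies over a single point, hence is constant, and
    -- uniqueness of `Abar`-horizontal lifts does the rest.
    have hpath : IsHorizontalPath A s₀ s₁ (fun s => F' (s, t₀)) := by
      refine ⟨hF'.smooth.comp (contDiff_id.prodMk contDiff_const).contMDiff.contMDiffOn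
        (fun s hs => ⟨hs, ht₀⟩), fun u hu => ?_⟩
      rw [← hint F' hF'.smooth hF'Γ u hu]
      exact hF'.horizontal u hu
    rintro ⟨u, v⟩ ⟨hu, hv⟩
    refine IsHorizontalLift.eqOn hAbar hπ ht (hF'.lift u hu) (hlift u hu) ?_ hv
    have h1 := hpath.eq_of_proj_const hA hπ hs (fun s hs => by
      rw [hF'Γ (s, t₀) ⟨hs, ht₀⟩, hF'Γ (s₀, t₀) ⟨hs₀, ht₀⟩, hleft s hs]) hu
    exact h1.trans ((hF'₀ ht₀).trans (hleft' u hu).symm)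
  -- The direction killed by the derivative of `Γ` is also killed by that of `F`: its image is
  -- vertical and `Abar`-horizontal.
  · refine IsThin.of_ker hs ht hFd fun u hu v hv => ?_
    obtain ⟨c, d, hcd, h0⟩ := hthin.exists_ker hs ht hu hv
      ((hΓ (u, v) ⟨hu, hv⟩).mdifferentiableWithinAt (by simp))
    refine ⟨c, d, hcd, hAbar.eq_zero_of_vertical hπ ?_ ((hF (u, v) ⟨hu, hv⟩).1.horizontal (c, d))⟩
    exact (mfderiv_proj_mfderivWithin hπ.smooth_proj hSu (fun x hx => (hF x hx).2) ⟨hu, hv⟩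
      (hFd u hu v hv) (c, d)).trans h0
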